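/- Let $\Sigma$ be a closed surface, that is, a compact connected smooth $2$-manifold without boundary, with a fixed smooth Riemannian metric $\sigma$ and a fixed $C^1$ $1$-form $\alpha_H$ (the connection $1$-form). Let $\nabla$, $\Delta$ and $d\Sigma$ be the gradient, the Laplace–Beltrami operator and the area measure of $\sigma$. For a positive $C^1$ function $|H|$ on $\Sigma$ (the norm of a spacelike mean curvature vector) and a $C^3$ function $\tau$ on $\Sigma$ (the time function), define $\theta$ by \[ \sinh\theta=\frac{-\Delta\tau}{|H|\sqrt{1+|\nabla\tau|^2}} . \] The physical Hamiltonian of $(\sigma,|H|,\alpha_H)$ with respect to $\tau$ is \[ \int_\Sigma\left[\sqrt{1+|\nabla\tau|^2}\,\cosh\theta\,|H|-\nabla\tau\cdot\nabla\theta-\alpha_H(\nabla\tau)\right]d\Sigma . \] Then there exist $\epsilon>0$ and $b>0$, depending only on $(\Sigma,\sigma,\alpha_H)$, such that for every positive $C^1$ function $|H|$ on $\Sigma$ with $|H|<\epsilon$ everywhere, and for every $C^3$ time function $\tau$ on $\Sigma$, \[ \int_\Sigma\left[\sqrt{1+|\nabla\tau|^2}\,\cosh\theta\,|H|-\nabla\tau\cdot\nabla\theta-\alpha_H(\nabla\tau)\right]d\Sigma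 \;<\;\cosh b\int_\Sigma|H|\,d\Sigma . \] -/

import Mathlib

open scoped Manifold ContDiff
open MeasureTheory

noncomputable section

namespace QuasiLocal

/-- The model space `ℝ²` of a surface. -/
abbrev Plane : Type := EuclideanSpace ℝ (Fin 2)

/-- The `i`-th partial derivative, at `y`, of a real function on the plane. -/
def partialDeriv (i : Fin 2) (u : Plane → ℝ) (y : Plane) : ℝ :=
  fderiv ℝ u y (EuclideanSpace.single i (1 : ℝ))

section Metric

variable {M : Type*} [TopologicalSpace M] [ChartedSpace Plane M] [IsManifold (𝓡 2) ∞ M]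

variable (M) in
/-- A smooth Riemannian metric on the surface `M`. -/
abbrev Metric : Type _ :=
  Bundle.ContMDiffRiemannianMetric (𝓡 2) ∞ Plane (fun x : M => TangentSpace (𝓡 2) x)

/-- The linear isomorphism `v ↦ σ(v, ·)` from tangent vectors to covectors is injective. -/
theorem flat_injective (σ : Metric M) (x : M) : Function.Injective (σ.inner x) := by
  refine (injective_iff_map_eq_zero _).2 fun v hv => ?_
  by_contra hne
  have h := σ.pos x v hne
  rw [hv] at h
  exact lt_irrefl _ h

theorem existsUnique_sharp (σ : Metric M) (x : M) (ξ : TangentSpace (𝓡 2) x →L[ℝ] ℝ) :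
    ∃! v : TangentSpace (𝓡 2) x, ∀ w, σ.inner x v w = ξ w := by
  have : FiniteDimensional ℝ (TangentSpace (𝓡 2) x) :=
    inferInstanceAs (FiniteDimensional ℝ Plane)
  let L : TangentSpace (𝓡 2) x →ₗ[ℝ] Module.Dual ℝ (TangentSpace (𝓡 2) x) :=
    { toFun := fun v => (σ.inner x v).toLinearMap
      map_add' := fun v w => by ext; simp
      map_smul' := fun c v => by ext; simp }
  have hinj : Function.Injective L := fun v w h =>
    flat_injective σ x (ContinuousLinearMap.coe_injective h)
  have hsurj : Function.Surjective L :=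
    (LinearMap.injective_iff_surjective_of_finrank_eq_finrank
      (Subspace.dual_finrank_eq (K := ℝ) (V := TangentSpace (𝓡 2) x)).symm).1 hinj
  obtain ⟨v, hv⟩ := hsurj ξ.toLinearMap
  refine ⟨v, fun w => LinearMap.congr_fun hv w, fun v' hv' => hinj ?_⟩
  rw [hv]
  exact LinearMap.ext hv'

/-- The gradient `∇f` at `x`: the tangent vector with `σ(∇f, w) = df(w)` for all `w`. -/
def grad (σ : Metric M) (f : M → ℝ) (x : M) : TangentSpace (𝓡 2) x :=
  (existsUnique_sharp σ x (mfderiv (𝓡 2) 𝓘(ℝ, ℝ) f x)).choose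

theorem inner_grad (σ : Metric M) (f : M → ℝ) (x : M) (w : TangentSpace (𝓡 2) x) :
    σ.inner x (grad σ f x) w = mfderiv (𝓡 2) 𝓘(ℝ, ℝ) f x w :=
  (existsUnique_sharp σ x (mfderiv (𝓡 2) 𝓘(ℝ, ℝ) f x)).choose_spec.1 w

/-- `√(1 + |∇f|²)` at `x`. -/
def gradFactor (σ : Metric M) (f : M → ℝ) (x : M) : ℝ :=
  √(1 + σ.inner x (grad σ f x) (grad σ f x))

/-- The coordinate vector field `∂ᵢ` of the chart `e`, at the point with coordinates `y`. -/
def coordVec (e : OpenPartialHomeomorph M Plane) (i : Fin 2) (y : Plane) :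
    TangentSpace (𝓡 2) (e.symm y) :=
  mfderiv (𝓡 2) (𝓡 2) e.symm y (EuclideanSpace.single i (1 : ℝ) : Plane)

/-- The matrix `(σᵢⱼ)` of the metric in the chart `e`, at the point with coordinates `y`. -/
def gram (σ : Metric M) (e : OpenPartialHomeomorph M Plane) (y : Plane) :
    Matrix (Fin 2) (Fin 2) ℝ :=
  Matrix.of fun i j => σ.inner (e.symm y) (coordVec e i y) (coordVec e j y)

/-- The area density `√det(σᵢⱼ)` in the chart `e`. -/
def areaDensity (σ : Metric M) (e : OpenPartialHomeomorph M Plane) (y : Plane) : ℝ :=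
  √(gram σ e y).det

/-- The Laplacian in the chart `e`, at the point with coordinates `y`:
`(1 / √det σ) ∑ᵢⱼ ∂ᵢ (√det σ σⁱʲ ∂ⱼ f)`. -/
def laplacianIn (σ : Metric M) (e : OpenPartialHomeomorph M Plane) (f : M → ℝ) (y : Plane) : ℝ :=
  (areaDensity σ e y)⁻¹ * ∑ i, ∑ j,
    partialDeriv i
      (fun z => areaDensity σ e z * (gram σ e z)⁻¹ i j * partialDeriv j (f ∘ e.symm) z) y

/-- The Laplace–Beltrami operator `Δ` of `σ`. Its value at `x` does not depend on the chart
around `x`; the preferred chart at `x` is used. -/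
def laplacian (σ : Metric M) (f : M → ℝ) (x : M) : ℝ :=
  laplacianIn σ (chartAt Plane x) f (chartAt Plane x x)

/-- `α` is a 1-form of class `C¹`, that is, a `C¹` section of the
cotangent bundle. -/
def IsC1OneForm (α : (x : M) → TangentSpace (𝓡 2) x →L[ℝ] ℝ) : Prop :=
  ContMDiff (𝓡 2) ((𝓡 2).prod 𝓘(ℝ, Plane →L[ℝ] ℝ)) 1
    (fun x => Bundle.TotalSpace.mk' (Plane →L[ℝ] ℝ)
      (E := fun x : M => TangentSpace (𝓡 2) x →L[ℝ] Bundle.Trivial M ℝ x) x (α x))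

variable (M) in
/-- A smooth partition of unity subordinate to the charts of the surface. -/
def chartPartition [T2Space M] [SigmaCompactSpace M] :
    SmoothPartitionOfUnity M (𝓡 2) M Set.univ :=
  (SmoothPartitionOfUnity.exists_isSubordinate_chartAt_source (𝓡 2) M).choose

variable (M) in
theorem chartPartition_isSubordinate [T2Space M] [SigmaCompactSpace M] :
    (chartPartition M).IsSubordinate (fun p => (chartAt Plane p).source) :=
  (SmoothPartitionOfUnity.exists_isSubordinate_chartAt_source (𝓡 2) M).choose_spec

section Area

variable [MeasurableSpace M]

/-- The area measure in the chart `e`: the image, under the inverse chart, of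
`√det(σᵢⱼ) dy` on the range of the chart. -/
def chartArea (σ : Metric M) (e : OpenPartialHomeomorph M Plane) : Measure M :=
  ((volume.restrict e.target).withDensity
    (fun y => ENNReal.ofReal (areaDensity σ e y))).map e.symm

/-- The area measure `dΣ` of the metric `σ`: the sum over a smooth partition of unity `(ρₚ)`
subordinate to the charts `(eₚ)` of the measures `ρₚ √det(σᵢⱼ) dy`.
It does not depend on the partition of unity. -/
def area [T2Space M] [SigmaCompactSpace M] (σ : Metric M) : Measure M :=
  Measure.sum fun p : M =>
    (chartArea σ (chartAt Plane p)).withDensity (fun x => ENNReal.ofReal (chartPartition M p x))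

end Area

/-- The angle `θ` with `sinh θ = -Δτ / (|H| √(1 + |∇τ|²))`; the positive function `h` is the
norm `|H|` of the spacelike mean curvature vector. -/
def angle (σ : Metric M) (h τ : M → ℝ) (x : M) : ℝ :=
  Real.arsinh (-laplacian σ τ x / (h x * gradFactor σ τ x))

/-- The physical Hamiltonian of the data `(σ, |H|, α_H) = (σ, h, α)` for the time function `τ`:
`∫ √(1 + |∇τ|²) cosh θ |H| - ∇τ · ∇θ - α_H(∇τ) dΣ`. -/
def physicalHamiltonian [MeasurableSpace M] [T2Space M] [SigmaCompactSpace M]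
    (σ : Metric M) (h : M → ℝ) (α : (x : M) → TangentSpace (𝓡 2) x →L[ℝ] ℝ) (τ : M → ℝ) : ℝ :=
  ∫ x, (gradFactor σ τ x * Real.cosh (angle σ h τ x) * h x
    - σ.inner x (grad σ τ x) (grad σ (angle σ h τ) x)
    - α x (grad σ τ x)) ∂(area σ)

end Metric

end QuasiLocal

end

open scoped Manifold ContDiff
open MeasureTheory

namespace QuasiLocal

set_option linter.unusedSectionVars false

/-! ### Coordinate frames, Gram matrices and gradients in a chart. -/

section Frame

open Set Topology

variable {M : Type*} [TopologicalSpace M] [ChartedSpace Plane M] [IsManifold (𝓡 2) ∞ M]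
  {e e' : OpenPartialHomeomorph M Plane}

/-! Write `w = √(1 + |∇τ|²)` and `h = |H|`. The definition of `θ` says `Δτ = -w h sinh θ`, so
Green's formula turns `-∫ ∇τ·∇θ` into `∫ θ Δτ = -∫ w h θ sinh θ`, and the Hamiltonian becomes `∫ w h
(cosh θ - θ sinh θ) - α(∇τ)` (`physicalHamiltonian_eq`). Derivatives of `θ` have disappeared.

The tangent line to `cosh` at `θ`, evaluated at `±K`, gives `cosh θ - θ sinh θ ≤ cosh K - K |sinh
θ|` (`cosh_sub_mul_sinh_add_le`). Multiplied by `w h`, the last term is exactly `-K |Δτ|`. Since `w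
≤ 1 + |∇τ|`, the smallness condition `h cosh K ≤ 1` gives `w h cosh K ≤ h cosh K + |∇τ|`; and
`|α(∇τ)| ≤ a |∇τ|` by compactness. The Hamiltonian is thus at most `cosh K ∫ h + (a + 1) ‖∇τ‖₁ - K
‖Δτ‖₁`.

What remains is the linear estimate `‖∇τ‖₁ ≤ C ‖Δτ‖₁` (`exists_integral_gradNorm_le`); then `K = C
(a + 1)` absorbs the gradient term. To prove it, set `s = ‖∇f‖₁` and test `Δf` against the bounded
function `arctan((f - m)/s)`. This controls the integral of `s |∇f|² / (s² + (f - m)²)` by `‖Δf‖₁`;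
Young's inequality recovers `‖∇f‖₁`, provided `‖f - m‖₂ ≤ C ‖∇f‖₁`. That Sobolev–Poincaré inequality
is proved on squares and propagated over the connected compact surface
(`exists_lintegral_enorm_sub_sq_le`).

The definitions of `area` and `laplacian` depend on choices of charts, so a preliminary part shows
that these choices do not matter and proves Green's formula. -/

theorem contMDiffOn_symm (he : e ∈ atlas Plane M) :
    ContMDiffOn (𝓡 2) (𝓡 2) ∞ e.symm e.target :=
  contMDiffOn_symm_of_mem_maximalAtlas (StructureGroupoid.subset_maximalAtlas _ he)

theorem contMDiffOn_chart (he : e ∈ atlas Plane M) :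
    ContMDiffOn (𝓡 2) (𝓡 2) ∞ e e.source :=
  contMDiffOn_of_mem_maximalAtlas (StructureGroupoid.subset_maximalAtlas _ he)

theorem mdifferentiable_chart (he : e ∈ atlas Plane M) : e.MDifferentiable (𝓡 2) (𝓡 2) :=
  have : IsManifold (𝓡 2) 1 M := IsManifold.of_le (n := ∞) (by simp)
  mdifferentiable_of_mem_atlas he

theorem contMDiffOn_coordVec (he : e ∈ atlas Plane M) (i : Fin 2) :
    ContMDiffOn (𝓡 2) ((𝓡 2).prod 𝓘(ℝ, Plane)) ∞
      (fun y => Bundle.TotalSpace.mk' Plane (E := fun x : M => TangentSpace (𝓡 2) x)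
        (e.symm y) (coordVec e i y)) e.target := by
  have h := (contMDiffOn_symm he).contMDiffOn_tangentMapWithin (m := ∞) (n := ∞) (by simp)
    e.open_target.uniqueMDiffOn
  have hc : ContMDiff (𝓡 2) ((𝓡 2).prod 𝓘(ℝ, Plane)) ∞
      (fun y : Plane => (⟨y, (EuclideanSpace.single i (1 : ℝ) : Plane)⟩ :
        TangentBundle (𝓡 2) Plane)) := by
    intro y
    exact contMDiffAt_vectorSpace_iff_contDiffAt.2 contDiffAt_const
  refine (h.comp hc.contMDiffOn (fun y hy => hy)).congr fun y hy => ?_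
  simp only [Function.comp, tangentMapWithin]
  rw [mfderivWithin_of_isOpen e.open_target hy]
  rfl

theorem contDiffOn_gram (σ : Metric M) (he : e ∈ atlas Plane M) (i j : Fin 2) :
    ContDiffOn ℝ ∞ (fun y => gram σ e y i j) e.target := by
  rw [← contMDiffOn_iff_contDiffOn]
  intro y hy
  have : ContMDiffWithinAt (𝓡 2) ((𝓡 2).prod 𝓘(ℝ)) ∞
      (fun m ↦ Bundle.TotalSpace.mk' ℝ (E := Bundle.Trivial M ℝ) (e.symm m)
        (σ.inner (e.symm m) (coordVec e i m) (coordVec e j m))) e.target y := by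
    apply ContMDiffWithinAt.clm_bundle_apply₂ (F₁ := Plane) (F₂ := Plane)
    · exact ContMDiffAt.comp_contMDiffWithinAt y σ.contMDiff.contMDiffAt (contMDiffOn_symm he y hy)
    · exact contMDiffOn_coordVec he i y hy
    · exact contMDiffOn_coordVec he j y hy
  simp only [Bundle.contMDiffWithinAt_totalSpace] at this
  exact this.2

theorem continuousOn_oneForm_coordVec {α : (x : M) → TangentSpace (𝓡 2) x →L[ℝ] ℝ}
    (hα : IsC1OneForm α) (he : e ∈ atlas Plane M) (i : Fin 2) :
    ContinuousOn (fun y => α (e.symm y) (coordVec e i y)) e.target := by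
  have : ContMDiffOn (𝓡 2) 𝓘(ℝ) 1 (fun y => α (e.symm y) (coordVec e i y)) e.target := by
    intro y hy
    have : ContMDiffWithinAt (𝓡 2) ((𝓡 2).prod 𝓘(ℝ)) 1
        (fun m ↦ Bundle.TotalSpace.mk' ℝ (E := Bundle.Trivial M ℝ) (e.symm m)
          (α (e.symm m) (coordVec e i m))) e.target y := by
      apply ContMDiffWithinAt.clm_bundle_apply (F₁ := Plane)
      · exact ContMDiffAt.comp_contMDiffWithinAt y hα.contMDiffAt
          ((contMDiffOn_symm he y hy).of_le (by simp))
      · exact (contMDiffOn_coordVec he i y hy).of_le (by simp)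
    simp only [Bundle.contMDiffWithinAt_totalSpace] at this
    exact this.2
  exact this.continuousOn

theorem mfderiv_coordVec (he : e ∈ atlas Plane M) {f : M → ℝ} {y : Plane} (hy : y ∈ e.target)
    (hf : MDifferentiableAt (𝓡 2) 𝓘(ℝ, ℝ) f (e.symm y)) (i : Fin 2) :
    mfderiv (𝓡 2) 𝓘(ℝ, ℝ) f (e.symm y) (coordVec e i y) = partialDeriv i (f ∘ e.symm) y := by
  have h := mfderiv_comp (I' := 𝓡 2) y hf ((mdifferentiable_chart he).mdifferentiableAt_symm hy)
  rw [partialDeriv, ← mfderiv_eq_fderiv, h]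
  rfl

/-- A tangent vector at `e.symm y` is a combination of the coordinate vectors. -/
theorem exists_eq_sum_coordVec (he : e ∈ atlas Plane M) {y : Plane} (hy : y ∈ e.target)
    (v : TangentSpace (𝓡 2) (e.symm y)) : ∃ a : Fin 2 → ℝ, v = ∑ i, a i • coordVec e i y := by
  obtain ⟨w, hw⟩ := (mdifferentiable_chart he).symm.mfderiv_surjective hy v
  let w' : Plane := w
  refine ⟨fun i => w' i, ?_⟩
  have hs : w' = ∑ i, w' i • (EuclideanSpace.single i (1 : ℝ) : Plane) := by
    ext j
    fin_cases j <;> simp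
  have : v = mfderiv (𝓡 2) (𝓡 2) e.symm y w' := hw.symm
  rw [this, hs]
  simp only [Fin.sum_univ_two]
  exact (map_add _ _ _).trans (congrArg₂ _ (map_smul _ _ _) (map_smul _ _ _)) |>.trans (by
    simp [coordVec])

theorem sum_coordVec_eq_zero (he : e ∈ atlas Plane M) {y : Plane} (hy : y ∈ e.target)
    {a : Fin 2 → ℝ} (h : ∑ i, a i • coordVec e i y = 0) : a = 0 := by
  have hinj := (mdifferentiable_chart he).symm.mfderiv_injective hy
  let w : Plane := ∑ i, a i • (EuclideanSpace.single i (1 : ℝ) : Plane)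
  have hw : mfderiv (𝓡 2) (𝓡 2) e.symm y w = 0 := by
    rw [← h]
    simp only [w, Fin.sum_univ_two]
    exact (map_add _ _ _).trans (congrArg₂ _ (map_smul _ _ _) (map_smul _ _ _))
  have hw0 : w = 0 := hinj (hw.trans (map_zero _).symm)
  ext j
  have := congrArg (fun u : Plane => u j) hw0
  fin_cases j <;> simpa [w] using this

theorem inner_sum_coordVec (σ : Metric M) (y : Plane) (a b : Fin 2 → ℝ) :
    σ.inner (e.symm y) (∑ i, a i • coordVec e i y) (∑ i, b i • coordVec e i y)
      = ∑ i, ∑ j, a i * b j * gram σ e y i j := by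
  simp [gram, Fin.sum_univ_two]
  ring

theorem gram_comm (σ : Metric M) (y : Plane) (i j : Fin 2) : gram σ e y i j = gram σ e y j i :=
  σ.symm _ _ _

theorem gram_posDef (σ : Metric M) (he : e ∈ atlas Plane M) {y : Plane} (hy : y ∈ e.target)
    {a : Fin 2 → ℝ} (ha : a ≠ 0) : 0 < ∑ i, ∑ j, a i * a j * gram σ e y i j := by
  rw [← inner_sum_coordVec]
  exact σ.pos _ _ fun h => ha (sum_coordVec_eq_zero he hy h)

theorem gram_zero_zero_pos (σ : Metric M) (he : e ∈ atlas Plane M) {y : Plane}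
    (hy : y ∈ e.target) : 0 < gram σ e y 0 0 := by
  have := gram_posDef σ he hy (a := ![1, 0]) (by simp)
  simpa [Fin.sum_univ_two] using this

theorem gram_det_pos (σ : Metric M) (he : e ∈ atlas Plane M) {y : Plane} (hy : y ∈ e.target) :
    0 < (gram σ e y).det := by
  have h0 := gram_zero_zero_pos σ he hy
  -- On the vector `(-g₀₁, g₀₀)` the quadratic form takes the value `g₀₀ · det g`.
  have := gram_posDef σ he hy (a := ![- gram σ e y 0 1, gram σ e y 0 0])
    (fun h => h0.ne' (congrFun h 1))
  rw [Matrix.det_fin_two]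
  simp [Fin.sum_univ_two] at this
  rw [gram_comm σ y 1 0] at this ⊢
  refine pos_of_mul_pos_right (a := gram σ e y 0 0) ?_ h0.le
  linarith

theorem areaDensity_pos (σ : Metric M) (he : e ∈ atlas Plane M) {y : Plane} (hy : y ∈ e.target) :
    0 < areaDensity σ e y :=
  Real.sqrt_pos.2 (gram_det_pos σ he hy)

theorem contDiffOn_gram_det (σ : Metric M) (he : e ∈ atlas Plane M) :
    ContDiffOn ℝ ∞ (fun y => (gram σ e y).det) e.target := by
  simp only [Matrix.det_fin_two]
  exact ((contDiffOn_gram σ he 0 0).mul (contDiffOn_gram σ he 1 1)).sub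
    ((contDiffOn_gram σ he 0 1).mul (contDiffOn_gram σ he 1 0))

theorem contDiffOn_areaDensity (σ : Metric M) (he : e ∈ atlas Plane M) :
    ContDiffOn ℝ ∞ (areaDensity σ e) e.target :=
  (contDiffOn_gram_det σ he).sqrt fun _ hy => (gram_det_pos σ he hy).ne'

theorem contDiffOn_gram_inv (σ : Metric M) (he : e ∈ atlas Plane M) (i j : Fin 2) :
    ContDiffOn ℝ ∞ (fun y => (gram σ e y)⁻¹ i j) e.target := by
  have hd := (contDiffOn_gram_det σ he).inv fun _ hy => (gram_det_pos σ he hy).ne'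
  have h : ∀ y, (gram σ e y)⁻¹ i j = ((gram σ e y).det)⁻¹ * (gram σ e y).adjugate i j := by
    intro y
    simp [Matrix.inv_def]
  simp only [h]
  refine hd.mul ?_
  fin_cases i <;> fin_cases j <;> simp [Matrix.adjugate_fin_two]
  · exact contDiffOn_gram σ he 1 1
  · exact (contDiffOn_gram σ he 0 1).neg
  · exact (contDiffOn_gram σ he 1 0).neg
  · exact contDiffOn_gram σ he 0 0

/-- The vector dual to a covector `ξ`, in coordinates. -/
theorem eq_sum_gram_inv (σ : Metric M) (he : e ∈ atlas Plane M) {y : Plane} (hy : y ∈ e.target)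
    {v : TangentSpace (𝓡 2) (e.symm y)} {ξ : TangentSpace (𝓡 2) (e.symm y) →L[ℝ] ℝ}
    (h : ∀ w, σ.inner (e.symm y) v w = ξ w) :
    v = ∑ i, (∑ j, (gram σ e y)⁻¹ i j * ξ (coordVec e j y)) • coordVec e i y := by
  obtain ⟨a, rfl⟩ := exists_eq_sum_coordVec he hy v
  have hb : Matrix.mulVec (gram σ e y) a = fun j => ξ (coordVec e j y) := by
    ext j
    rw [← h, Matrix.mulVec, dotProduct]
    simp only [Fin.sum_univ_two, map_add, map_smul, add_apply,
      smul_apply, smul_eq_mul]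
    rw [gram_comm, gram_comm σ y j 1]
    simp [gram]
    ring
  have ha : a = Matrix.mulVec (gram σ e y)⁻¹ fun j => ξ (coordVec e j y) := by
    rw [← hb, Matrix.mulVec_mulVec, Matrix.nonsing_inv_mul _ (gram_det_pos σ he hy).ne'.isUnit,
      Matrix.one_mulVec]
  refine Finset.sum_congr rfl fun i _ => ?_
  conv_lhs => rw [ha]
  rfl

theorem apply_grad (σ : Metric M) (he : e ∈ atlas Plane M) {y : Plane} (hy : y ∈ e.target)
    {f : M → ℝ} (hf : MDifferentiableAt (𝓡 2) 𝓘(ℝ, ℝ) f (e.symm y))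
    (ξ : TangentSpace (𝓡 2) (e.symm y) →L[ℝ] ℝ) :
    ξ (grad σ f (e.symm y)) =
      ∑ i, ∑ j, (gram σ e y)⁻¹ i j * ξ (coordVec e i y) * partialDeriv j (f ∘ e.symm) y := by
  rw [eq_sum_gram_inv σ he hy (inner_grad σ f (e.symm y)), map_sum]
  refine Finset.sum_congr rfl fun i _ => ?_
  rw [map_smul, smul_eq_mul, Finset.sum_mul]
  refine Finset.sum_congr rfl fun j _ => ?_
  exact (congrArg (fun t : ℝ => (gram σ e y)⁻¹ i j * t * ξ (coordVec e i y))
    (mfderiv_coordVec he hy hf j)).trans (by ring)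

/-- The scalar product of two gradients, in coordinates. -/
theorem inner_grad_grad (σ : Metric M) (he : e ∈ atlas Plane M) {y : Plane} (hy : y ∈ e.target)
    {f g : M → ℝ} (hf : MDifferentiableAt (𝓡 2) 𝓘(ℝ, ℝ) f (e.symm y))
    (hg : MDifferentiableAt (𝓡 2) 𝓘(ℝ, ℝ) g (e.symm y)) :
    σ.inner (e.symm y) (grad σ f (e.symm y)) (grad σ g (e.symm y)) =
      ∑ i, ∑ j, (gram σ e y)⁻¹ i j * partialDeriv i (f ∘ e.symm) y
        * partialDeriv j (g ∘ e.symm) y := by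
  refine (inner_grad σ f _ _).trans ((apply_grad σ he hy hg
    (mfderiv (𝓡 2) 𝓘(ℝ, ℝ) f (e.symm y))).trans ?_)
  refine Finset.sum_congr rfl fun i _ => Finset.sum_congr rfl fun j _ => ?_
  exact congrArg (fun t : ℝ => (gram σ e y)⁻¹ i j * t * partialDeriv j (g ∘ e.symm) y)
    (mfderiv_coordVec he hy hf i)

end Frame

/-! ### Transformation of frames and area density under a change of chart. -/

section ChartChange

open Set Topology

variable {M : Type*} [TopologicalSpace M] [ChartedSpace Plane M] [IsManifold (𝓡 2) ∞ M]
  {e e' : OpenPartialHomeomorph M Plane}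

theorem contDiffOn_transition (he : e ∈ atlas Plane M) (he' : e' ∈ atlas Plane M) :
    ContDiffOn ℝ ∞ (e' ∘ e.symm) (e.target ∩ e.symm ⁻¹' e'.source) := by
  rw [← contMDiffOn_iff_contDiffOn]
  exact (contMDiffOn_chart he').comp ((contMDiffOn_symm he).mono inter_subset_left)
    fun y hy => hy.2

theorem isOpen_overlap (e e' : OpenPartialHomeomorph M Plane) :
    IsOpen (e.target ∩ e.symm ⁻¹' e'.source) :=
  e.isOpen_inter_preimage_symm e'.open_source

theorem differentiableAt_transition (he : e ∈ atlas Plane M) (he' : e' ∈ atlas Plane M)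
    {y : Plane} (hy : y ∈ e.target ∩ e.symm ⁻¹' e'.source) :
    DifferentiableAt ℝ (e' ∘ e.symm) y :=
  ((contDiffOn_transition he he').contDiffAt ((isOpen_overlap e e').mem_nhds hy)).differentiableAt
    (by simp)

/-- The coordinate vectors of two charts are related by the derivative of the transition map. -/
theorem coordVec_eq_sum (he : e ∈ atlas Plane M) (he' : e' ∈ atlas Plane M)
    {y : Plane} (hy : y ∈ e.target ∩ e.symm ⁻¹' e'.source) (i : Fin 2) :
    (coordVec e i y : Plane) = ∑ k, (fderiv ℝ (e' ∘ e.symm) y (EuclideanSpace.single i 1)) k •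
      (coordVec e' k ((e' ∘ e.symm) y) : Plane) := by
  have hev : e.symm =ᶠ[𝓝 y] e'.symm ∘ (e' ∘ e.symm) := by
    filter_upwards [(isOpen_overlap e e').mem_nhds hy] with z hz
    exact (e'.left_inv hz.2).symm
  have hd := (mdifferentiable_chart he').mdifferentiableAt_symm (e'.map_source hy.2)
  have h := mfderiv_comp (I' := 𝓡 2) y (g := e'.symm) (f := e' ∘ e.symm) hd
    (differentiableAt_transition he he' hy).mdifferentiableAt
  rw [← hev.mfderiv_eq] at h
  set w : Plane := fderiv ℝ (e' ∘ e.symm) y (EuclideanSpace.single i 1) with hw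
  have hws : w = ∑ k, w k • (EuclideanSpace.single k (1 : ℝ) : Plane) := by
    ext j
    fin_cases j <;> simp
  have h1 : (coordVec e i y : Plane) = mfderiv (𝓡 2) (𝓡 2) e'.symm ((e' ∘ e.symm) y) w := by
    rw [hw, ← mfderiv_eq_fderiv]
    exact congrArg (fun L => L (EuclideanSpace.single i (1 : ℝ) : Plane)) h
  rw [h1]
  conv_lhs => rw [hws]
  simp only [Fin.sum_univ_two]
  exact (map_add _ _ _).trans (congrArg₂ _ (map_smul _ _ _) (map_smul _ _ _))

/-- The Gram matrices are related by `G = Jᵀ G' J`, where `J` is the Jacobian matrix of the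
transition map; taking determinants and square roots gives the factor `|det J|`. -/
theorem areaDensity_transition (σ : Metric M) (he : e ∈ atlas Plane M) (he' : e' ∈ atlas Plane M)
    {y : Plane} (hy : y ∈ e.target ∩ e.symm ⁻¹' e'.source) :
    areaDensity σ e y = |(fderiv ℝ (e' ∘ e.symm) y).det| *
      areaDensity σ e' ((e' ∘ e.symm) y) := by
  set J : Matrix (Fin 2) (Fin 2) ℝ := Matrix.of fun k i =>
    (fderiv ℝ (e' ∘ e.symm) y (EuclideanSpace.single i 1)) k with hJ
  have hdet : (fderiv ℝ (e' ∘ e.symm) y).det = J.det := by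
    rw [ContinuousLinearMap.det, ← LinearMap.det_toMatrix (EuclideanSpace.basisFun (Fin 2) ℝ).toBasis]
    congr 1
  -- The two base points agree only through the equation `hx`. Regarding the metric as a family of
  -- forms on the fixed space `Plane` lets both Gram matrices be computed with one form.
  let B : M → Plane →L[ℝ] Plane →L[ℝ] ℝ := fun x => σ.inner x
  have hx : e'.symm ((e' ∘ e.symm) y) = e.symm y := e'.left_inv hy.2
  have hg' : ∀ k l, gram σ e' ((e' ∘ e.symm) y) k l =
      B (e.symm y) (coordVec e' k ((e' ∘ e.symm) y) : Plane)
        (coordVec e' l ((e' ∘ e.symm) y) : Plane) := by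
    intro k l
    rw [← hx]
    rfl
  have hsum : ∀ (L : Plane →L[ℝ] Plane →L[ℝ] ℝ) (c : Fin 2 → Plane) (a b : Fin 2 → ℝ),
      L (∑ k, a k • c k) (∑ k, b k • c k) = ∑ l, (∑ k, a k * L (c k) (c l)) * b l := by
    intro L c a b
    simp [Fin.sum_univ_two]
    ring
  have hg : ∀ i j, gram σ e y i j =
      B (e.symm y) (coordVec e i y : Plane) (coordVec e j y : Plane) := fun _ _ => rfl
  have hgram : gram σ e y = J.transpose * gram σ e' ((e' ∘ e.symm) y) * J := by
    ext i j
    rw [hg, coordVec_eq_sum he he' hy i, coordVec_eq_sum he he' hy j]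
    refine (hsum _ (fun k => coordVec e' k ((e' ∘ e.symm) y)) _ _).trans ?_
    simp only [Matrix.mul_apply, hg', Matrix.transpose_apply, hJ, Matrix.of_apply]
  rw [areaDensity, hgram, hdet, Matrix.det_mul, Matrix.det_mul, Matrix.det_transpose, areaDensity,
    ← Real.sqrt_sq_eq_abs, ← Real.sqrt_mul (sq_nonneg _)]
  congr 1
  ring

end ChartChange

/-! ### The area measure: independence of charts, finiteness, positivity on open sets. -/

section AreaMeasure

open Set Topology

variable {M : Type*} [TopologicalSpace M] [ChartedSpace Plane M] [IsManifold (𝓡 2) ∞ M]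
  [MeasurableSpace M] [BorelSpace M] {e e' : OpenPartialHomeomorph M Plane}

theorem aemeasurable_areaDensity (σ : Metric M) (he : e ∈ atlas Plane M) :
    AEMeasurable (areaDensity σ e) (volume.restrict e.target) :=
  (contDiffOn_areaDensity σ he).continuousOn.aemeasurable e.open_target.measurableSet

theorem aemeasurable_symm (e : OpenPartialHomeomorph M Plane) :
    AEMeasurable e.symm (volume.restrict e.target) :=
  e.continuousOn_symm.aemeasurable e.open_target.measurableSet

theorem lintegral_chartArea (σ : Metric M) (he : e ∈ atlas Plane M) {f : M → ENNReal}
    (hf : Measurable f) :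
    ∫⁻ x, f x ∂(chartArea σ e) =
      ∫⁻ y in e.target, ENNReal.ofReal (areaDensity σ e y) * f (e.symm y) := by
  rw [chartArea, lintegral_map' hf.aemeasurable
    ((aemeasurable_symm e).mono_ac (withDensity_absolutelyContinuous _ _))]
  exact lintegral_withDensity_eq_lintegral_mul₀ (aemeasurable_areaDensity σ he).ennreal_ofReal
    (hf.comp_aemeasurable (aemeasurable_symm e))

/-- Both sides reduce to integrals over the overlap, where the change of variables formula for the
transition map and `areaDensity_transition` identify them. -/
theorem lintegral_chartArea_eq (σ : Metric M) (he : e ∈ atlas Plane M) (he' : e' ∈ atlas Plane M)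
    {f : M → ENNReal} (hf : Measurable f) (h0 : ∀ x ∉ e.source ∩ e'.source, f x = 0) :
    ∫⁻ x, f x ∂(chartArea σ e) = ∫⁻ x, f x ∂(chartArea σ e') := by
  have key : ∀ {e e' : OpenPartialHomeomorph M Plane}, e ∈ atlas Plane M →
      (∀ x ∉ e.source ∩ e'.source, f x = 0) → ∫⁻ x, f x ∂(chartArea σ e) =
      ∫⁻ y in e.target ∩ e.symm ⁻¹' e'.source,
        ENNReal.ofReal (areaDensity σ e y) * f (e.symm y) := by
    intro e e' he h0
    rw [lintegral_chartArea σ he hf]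
    rw [← lintegral_indicator e.open_target.measurableSet,
      ← lintegral_indicator (isOpen_overlap e e').measurableSet]
    refine lintegral_congr fun y => ?_
    by_cases hy : y ∈ e.target
    · by_cases hy' : e.symm y ∈ e'.source
      · simp [hy, hy']
      · simp [hy, hy', h0 _ fun hx => hy' hx.2]
    · simp [hy]
  have himage : (e' ∘ e.symm) '' (e.target ∩ e.symm ⁻¹' e'.source)
      = e'.target ∩ e'.symm ⁻¹' e.source := by
    ext z
    constructor
    · rintro ⟨y, hy, rfl⟩
      refine ⟨e'.map_source hy.2, ?_⟩
      rw [mem_preimage, Function.comp, e'.left_inv hy.2]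
      exact e.map_target hy.1
    · rintro hz
      refine ⟨e (e'.symm z), ⟨e.map_source hz.2, ?_⟩, ?_⟩
      · rw [mem_preimage, e.left_inv hz.2]
        exact e'.map_target hz.1
      · rw [Function.comp, e.left_inv hz.2, e'.right_inv hz.1]
  rw [key he h0, key he' fun x hx => h0 x fun h => hx h.symm, ← himage,
    lintegral_image_eq_lintegral_abs_det_fderiv_mul volume (isOpen_overlap e e').measurableSet
      (fun y hy => (differentiableAt_transition he he' hy).hasFDerivAt.hasFDerivWithinAt)]
  · refine setLIntegral_congr_fun (isOpen_overlap e e').measurableSet fun y hy => ?_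
    rw [areaDensity_transition σ he he' hy, ENNReal.ofReal_mul (abs_nonneg _), mul_assoc,
      Function.comp, e'.left_inv hy.2]
  · intro y hy z hz hyz
    have := e'.injOn hy.2 hz.2 hyz
    exact e.symm.injOn hy.1 hz.1 this

variable [T2Space M] [CompactSpace M]

/-- Each `ρₚ f` vanishes outside the overlap of `e` with the chart at `p`, so its integral can be
moved to `e`. Compactness leaves finitely many nonzero `ρₚ`, and they sum to `1`. -/
theorem lintegral_area_eq_chartArea (σ : Metric M) (he : e ∈ atlas Plane M)
    {f : M → ENNReal} (hf : Measurable f) (h0 : ∀ x ∉ e.source, f x = 0) :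
    ∫⁻ x, f x ∂(area σ) = ∫⁻ x, f x ∂(chartArea σ e) := by
  have hfin : {p : M | (Function.support (chartPartition M p)).Nonempty}.Finite :=
    (chartPartition M).locallyFinite.finite_nonempty_of_compact
  have hρ : ∀ p, Measurable fun x => ENNReal.ofReal (chartPartition M p x) := fun p =>
    (chartPartition M p).contMDiff.continuous.measurable.ennreal_ofReal
  have hp : ∀ p, ∫⁻ x, f x ∂((chartArea σ (chartAt Plane p)).withDensity
      (fun x => ENNReal.ofReal (chartPartition M p x))) =
      ∫⁻ x, ENNReal.ofReal (chartPartition M p x) * f x ∂(chartArea σ e) := by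
    intro p
    rw [lintegral_withDensity_eq_lintegral_mul _ (hρ p) hf]
    refine lintegral_chartArea_eq σ (chart_mem_atlas _ p) he ((hρ p).mul hf) fun x hx => ?_
    by_cases hxe : x ∈ e.source
    · have : x ∉ tsupport (chartPartition M p) := fun h =>
        hx ⟨chartPartition_isSubordinate M p h, hxe⟩
      simp [image_eq_zero_of_notMem_tsupport this]
    · simp [h0 x hxe]
  rw [area, lintegral_sum_measure]
  simp only [hp]
  rw [tsum_eq_sum (s := hfin.toFinset), ← lintegral_finsetSum]
  · refine lintegral_congr fun x => ?_
    rw [← Finset.sum_mul, ← ENNReal.ofReal_sum_of_nonneg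
      fun p _ => (chartPartition M).nonneg p x]
    have h1 := (chartPartition M).sum_eq_one (mem_univ x)
    rw [finsum_eq_sum_of_support_subset (s := hfin.toFinset)] at h1
    · rw [h1, ENNReal.ofReal_one, one_mul]
    · intro p hp
      exact hfin.mem_toFinset.2 ⟨x, hp⟩
  · intro p _
    exact (hρ p).mul hf
  · intro p hp
    have : ∀ x, chartPartition M p x = 0 := by
      intro x
      by_contra hx
      exact hp (hfin.mem_toFinset.2 ⟨x, hx⟩)
    simp [this]

/-- In a chart, the area measure is the area measure of the chart. -/
theorem area_restrict_source (σ : Metric M) (he : e ∈ atlas Plane M) :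
    (area σ).restrict e.source = chartArea σ e := by
  ext s hs
  rw [Measure.restrict_apply hs, ← lintegral_indicator_one (hs.inter e.open_source.measurableSet),
    lintegral_area_eq_chartArea σ he, ← lintegral_indicator_one hs,
    lintegral_chartArea σ he, lintegral_chartArea σ he]
  · refine setLIntegral_congr_fun e.open_target.measurableSet fun y hy => ?_
    have := e.map_target hy
    by_cases h : e.symm y ∈ s <;> simp [h, this]
  · exact measurable_one.indicator hs
  · exact measurable_one.indicator (hs.inter e.open_source.measurableSet)
  · exact measurable_one.indicator (hs.inter e.open_source.measurableSet)
  · intro x hx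
    simp [hx]

theorem setLIntegral_area (σ : Metric M) (he : e ∈ atlas Plane M) {f : M → ENNReal}
    (hf : Measurable f) {s : Set M} (hs : MeasurableSet s) (hse : s ⊆ e.source) :
    ∫⁻ x in s, f x ∂(area σ) = ∫⁻ y in e.target ∩ e.symm ⁻¹' s,
        ENNReal.ofReal (areaDensity σ e y) * f (e.symm y) := by
  have h1 : (area σ).restrict s = (chartArea σ e).restrict s := by
    rw [← area_restrict_source σ he, Measure.restrict_restrict hs, inter_eq_left.2 hse]
  rw [h1, ← lintegral_indicator hs, lintegral_chartArea σ he (hf.indicator hs)]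
  have hm : NullMeasurableSet (e.symm ⁻¹' s) (volume.restrict e.target) :=
    (aemeasurable_symm e).nullMeasurable hs
  rw [inter_comm, ← Measure.restrict_restrict₀ hm, ← lintegral_indicator₀ hm]
  refine lintegral_congr fun y => ?_
  by_cases h : e.symm y ∈ s <;> simp [h]

theorem setIntegral_area (σ : Metric M) (he : e ∈ atlas Plane M) {f : M → ℝ}
    (hf : Measurable f) :
    ∫ x in e.source, f x ∂(area σ) = ∫ y in e.target, areaDensity σ e y * f (e.symm y) := by
  rw [area_restrict_source σ he, chartArea, integral_map
    ((aemeasurable_symm e).mono_ac (withDensity_absolutelyContinuous _ _))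
    hf.aestronglyMeasurable, integral_withDensity_eq_integral_toReal_smul₀
      (aemeasurable_areaDensity σ he).ennreal_ofReal (by simp)]
  refine setIntegral_congr_fun e.open_target.measurableSet fun y hy => ?_
  simp [ENNReal.toReal_ofReal (areaDensity_pos σ he hy).le]

/-- On a small coordinate ball the density is bounded by continuity, so the measure is locally
finite; compactness of `M` does the rest. -/
instance isFiniteMeasure_area (σ : Metric M) : IsFiniteMeasure (area σ) := by
  have : IsLocallyFiniteMeasure (area σ) := by
    refine ⟨fun x => ?_⟩
    set e := chartAt Plane x
    have he := chart_mem_atlas Plane x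
    have hx : x ∈ e.source := mem_chart_source Plane x
    have hc : ContinuousAt (areaDensity σ e) (e x) :=
      (contDiffOn_areaDensity σ he).continuousOn.continuousAt
        (e.open_target.mem_nhds (e.map_source hx))
    obtain ⟨r, hr, hball⟩ := Metric.mem_nhds_iff.1 (Filter.inter_mem
      (e.open_target.mem_nhds (e.map_source hx)) (hc.eventually_lt continuousAt_const
        (lt_add_one (areaDensity σ e (e x)))))
    refine ⟨e.source ∩ e ⁻¹' Metric.ball (e x) r, (e.isOpen_inter_preimage
      Metric.isOpen_ball).mem_nhds ⟨hx, Metric.mem_ball_self hr⟩, ?_⟩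
    have hmeas := (e.isOpen_inter_preimage (Metric.isOpen_ball (x := e x) (ε := r))).measurableSet
    rw [← setLIntegral_one, setLIntegral_area σ he (f := fun _ => 1) measurable_const hmeas inter_subset_left]
    have hsub : e.target ∩ e.symm ⁻¹' (e.source ∩ e ⁻¹' Metric.ball (e x) r) ⊆
        Metric.ball (e x) r := by
      rintro y ⟨hy, -, hy'⟩
      rwa [mem_preimage, e.right_inv hy] at hy'
    calc _ ≤ ∫⁻ y in Metric.ball (e x) r, ENNReal.ofReal (areaDensity σ e y) * 1 :=
          lintegral_mono_set hsub
      _ ≤ ∫⁻ y in Metric.ball (e x) r, ENNReal.ofReal (areaDensity σ e (e x) + 1) := by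
          refine setLIntegral_mono measurable_const fun y hy => ?_
          rw [mul_one]
          exact ENNReal.ofReal_le_ofReal (le_of_lt (hball hy).2)
      _ < ⊤ := by
          rw [setLIntegral_const]
          exact ENNReal.mul_lt_top ENNReal.ofReal_lt_top measure_ball_lt_top
  infer_instance

/-- Needed twice: to pass from almost everywhere to everywhere for continuous functions, and to
compare mean values on overlapping open sets. -/
instance isOpenPosMeasure_area (σ : Metric M) : (area σ).IsOpenPosMeasure := by
  refine ⟨fun U hU ⟨x, hxU⟩ h0 => ?_⟩
  set e := chartAt Plane x
  have he := chart_mem_atlas Plane x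
  have hx : x ∈ e.source := mem_chart_source Plane x
  have hV : IsOpen (e.source ∩ U) := e.open_source.inter hU
  have h1 : ∫⁻ x in e.source ∩ U, 1 ∂(area σ) = 0 := by
    rw [setLIntegral_one]
    exact measure_mono_null inter_subset_right h0
  rw [setLIntegral_area σ he (f := fun _ => 1) measurable_const hV.measurableSet inter_subset_left] at h1
  have hW : IsOpen (e.target ∩ e.symm ⁻¹' (e.source ∩ U)) := e.isOpen_inter_preimage_symm hV
  rw [lintegral_eq_zero_iff'] at h1
  · have h2 : ∀ᵐ y ∂volume.restrict (e.target ∩ e.symm ⁻¹' (e.source ∩ U)), False := by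
      filter_upwards [h1, ae_restrict_mem hW.measurableSet] with y hy hyW
      simp at hy
      exact (areaDensity_pos σ he hyW.1).not_ge hy
    rw [Filter.eventually_false_iff_eq_bot, ae_eq_bot, Measure.restrict_eq_zero] at h2
    refine (hW.measure_pos volume ⟨e x, e.map_source hx, ?_⟩).ne' h2
    rw [mem_preimage, e.left_inv hx]
    exact ⟨hx, hxU⟩
  · refine (((contDiffOn_areaDensity σ he).continuousOn.mono inter_subset_left).aemeasurable
      hW.measurableSet).ennreal_ofReal.mul ?_
    exact aemeasurable_const

end AreaMeasure

/-! ### Green's formula and chart independence of the Laplacian. -/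

section GreenFormula

open Set Topology

theorem contDiffOn_partialDeriv {u : Plane → ℝ} {U : Set Plane} (hU : IsOpen U) {m n : ℕ∞}
    (hu : ContDiffOn ℝ n u U) (hmn : m + 1 ≤ n) (i : Fin 2) :
    ContDiffOn ℝ m (partialDeriv i u) U :=
  (hu.fderiv_of_isOpen hU (by exact_mod_cast hmn)).clm_apply contDiffOn_const

/-- Integration by parts in the plane against a compactly supported function. -/
theorem integral_mul_partialDeriv {U : Set Plane} (hU : IsOpen U) {ψ F : Plane → ℝ}
    (hψ : ContDiff ℝ 1 ψ) (hc : HasCompactSupport ψ) (hs : tsupport ψ ⊆ U)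
    (hF : ContDiffOn ℝ 1 F U) (i : Fin 2) :
    Integrable (fun y => ψ y * partialDeriv i F y) ∧
    Integrable (fun y => partialDeriv i ψ y * F y) ∧
    ∫ y, ψ y * partialDeriv i F y = - ∫ y, partialDeriv i ψ y * F y := by
  have hdψ : ContDiff ℝ 0 (partialDeriv i ψ) :=
    (hψ.fderiv_right (m := 0) (by simp)).clm_apply contDiff_const
  have hts : tsupport (partialDeriv i ψ) ⊆ tsupport ψ :=
    closure_minimal (fun y hy => by
      by_contra h
      refine hy ?_
      rw [partialDeriv, image_eq_zero_of_notMem_tsupport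
        fun h' => h (tsupport_fderiv_subset ℝ h')]
      rfl) (isClosed_tsupport ψ)
  have hcont : ∀ {f g : Plane → ℝ}, Continuous f → tsupport f ⊆ tsupport ψ →
      ContinuousOn g U → Integrable (fun y => f y * g y) := by
    intro f g hf hfs hg
    have hfs' : tsupport (fun y => f y * g y) ⊆ tsupport f := tsupport_mul_subset_left
    have : Continuous (fun y => f y * g y) :=
      (hf.continuousOn.mul hg).continuous_of_tsupport_subset hU (hfs'.trans (hfs.trans hs))
    exact this.integrable_of_hasCompactSupport
      (hc.of_isClosed_subset (isClosed_tsupport _) (hfs'.trans hfs))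
  have h1 := hcont hψ.continuous le_rfl
    (contDiffOn_partialDeriv (m := 0) (n := 1) hU hF (by simp) i).continuousOn
  have h2 := hcont hdψ.continuous hts hF.continuousOn
  exact ⟨h1, h2, integral_mul_fderiv_eq_neg_fderiv_mul_of_integrable h2 h1
    (hcont hψ.continuous le_rfl hF.continuousOn)
    (fun y _ => (hψ.differentiable (by simp)) y)
    (fun y hy => (hF.contDiffAt (hU.mem_nhds (hs hy))).differentiableAt (by simp))⟩

variable {M : Type*} [TopologicalSpace M] [ChartedSpace Plane M] [IsManifold (𝓡 2) ∞ M]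
  {e e' : OpenPartialHomeomorph M Plane}

theorem contDiffOn_comp_symm (he : e ∈ atlas Plane M) {n : ℕ∞} {f : M → ℝ}
    (hf : ContMDiff (𝓡 2) 𝓘(ℝ, ℝ) n f) : ContDiffOn ℝ n (f ∘ e.symm) e.target := by
  rw [← contMDiffOn_iff_contDiffOn]
  exact hf.comp_contMDiffOn ((contMDiffOn_symm he).of_le (by exact_mod_cast le_top))

/-- The scalar product `∇f · ∇g` as a function on the surface. -/
noncomputable def gradInner (σ : Metric M) (f g : M → ℝ) (x : M) : ℝ :=
  σ.inner x (grad σ f x) (grad σ g x)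

theorem gradInner_eq_mfderiv (σ : Metric M) (f g : M → ℝ) (x : M) :
    gradInner σ f g x = mfderiv (𝓡 2) 𝓘(ℝ, ℝ) f x (grad σ g x) :=
  inner_grad σ f x _

theorem gradInner_symm_apply (σ : Metric M) (he : e ∈ atlas Plane M) {y : Plane}
    (hy : y ∈ e.target) {f g : M → ℝ} (hf : ContMDiff (𝓡 2) 𝓘(ℝ, ℝ) 1 f)
    (hg : ContMDiff (𝓡 2) 𝓘(ℝ, ℝ) 1 g) :
    gradInner σ f g (e.symm y) = ∑ i, ∑ j, (gram σ e y)⁻¹ i j * partialDeriv i (f ∘ e.symm) y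
        * partialDeriv j (g ∘ e.symm) y :=
  inner_grad_grad σ he hy (hf.mdifferentiable (by simp) _) (hg.mdifferentiable (by simp) _)

theorem contMDiff_of_contDiffOn_comp_symm {n : ℕ∞} {f : M → ℝ}
    (h : ∀ e ∈ atlas Plane M, ContDiffOn ℝ n (f ∘ e.symm) e.target) :
    ContMDiff (𝓡 2) 𝓘(ℝ, ℝ) n f := by
  intro x
  set e := chartAt Plane x
  have he : e ∈ atlas Plane M := chart_mem_atlas Plane x
  have hx : x ∈ e.source := mem_chart_source Plane x
  have h1 : ContMDiffOn (𝓡 2) 𝓘(ℝ, ℝ) n ((f ∘ e.symm) ∘ e) e.source :=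
    (contMDiffOn_iff_contDiffOn.2 (h e he)).comp
      ((contMDiffOn_chart he).of_le (by exact_mod_cast le_top)) e.mapsTo
  refine (h1.contMDiffAt (e.open_source.mem_nhds hx)).congr_of_eventuallyEq ?_
  filter_upwards [e.open_source.mem_nhds hx] with z hz
  simp [e.left_inv hz]

theorem contMDiff_gradInner (σ : Metric M) {m n : ℕ∞} (hmn : m + 1 ≤ n) {f g : M → ℝ}
    (hf : ContMDiff (𝓡 2) 𝓘(ℝ, ℝ) n f) (hg : ContMDiff (𝓡 2) 𝓘(ℝ, ℝ) n g) :
    ContMDiff (𝓡 2) 𝓘(ℝ, ℝ) m (gradInner σ f g) := by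
  refine contMDiff_of_contDiffOn_comp_symm fun e he => ?_
  have hd : ∀ {f : M → ℝ}, ContMDiff (𝓡 2) 𝓘(ℝ, ℝ) n f → ∀ i,
      ContDiffOn ℝ m (partialDeriv i (f ∘ e.symm)) e.target := fun hf i =>
    contDiffOn_partialDeriv e.open_target (contDiffOn_comp_symm he hf) hmn i
  have hn : ((1 : ℕ∞) : WithTop ℕ∞) ≤ n := by exact_mod_cast le_add_self.trans hmn
  refine ContDiffOn.congr (f := fun y => ∑ i, ∑ j, (gram σ e y)⁻¹ i j *
    partialDeriv i (f ∘ e.symm) y * partialDeriv j (g ∘ e.symm) y) ?_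
    fun y hy => gradInner_symm_apply σ he hy (hf.of_le hn) (hg.of_le hn)
  exact ContDiffOn.sum fun i _ => ContDiffOn.sum fun j _ =>
    (((contDiffOn_gram_inv σ he i j).of_le (by exact_mod_cast le_top)).mul (hd hf i)).mul (hd hg j)

theorem continuous_gradInner (σ : Metric M) {f g : M → ℝ} (hf : ContMDiff (𝓡 2) 𝓘(ℝ, ℝ) 1 f)
    (hg : ContMDiff (𝓡 2) 𝓘(ℝ, ℝ) 1 g) : Continuous (gradInner σ f g) :=
  (contMDiff_gradInner σ (m := 0) (n := 1) (by simp) hf hg).continuous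

/-- The flux component `√det σ σⁱʲ ∂ⱼ f` is of class `C²`. -/
theorem contDiffOn_flux (σ : Metric M) (he : e ∈ atlas Plane M) {f : M → ℝ}
    (hf : ContMDiff (𝓡 2) 𝓘(ℝ, ℝ) 3 f) (i j : Fin 2) :
    ContDiffOn ℝ 2 (fun z => areaDensity σ e z * (gram σ e z)⁻¹ i j *
      partialDeriv j (f ∘ e.symm) z) e.target := by
  have h2 : ((2 : ℕ∞) : WithTop ℕ∞) ≤ ∞ := by exact_mod_cast le_top
  exact (((contDiffOn_areaDensity σ he).of_le h2).mul ((contDiffOn_gram_inv σ he i j).of_le h2)).mul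
    (contDiffOn_partialDeriv (m := 2) (n := 3) e.open_target (contDiffOn_comp_symm he hf)
      (by norm_num) j)

theorem contDiffOn_laplacianIn (σ : Metric M) (he : e ∈ atlas Plane M) {f : M → ℝ}
    (hf : ContMDiff (𝓡 2) 𝓘(ℝ, ℝ) 3 f) : ContDiffOn ℝ 1 (laplacianIn σ e f) e.target := by
  have h1 : ((1 : ℕ∞) : WithTop ℕ∞) ≤ ∞ := by exact_mod_cast le_top
  refine (((contDiffOn_areaDensity σ he).inv fun y hy => (areaDensity_pos σ he hy).ne').of_le
    h1).mul (ContDiffOn.sum fun i _ => ContDiffOn.sum fun j _ => ?_)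
  exact contDiffOn_partialDeriv (m := 1) (n := 2) e.open_target (contDiffOn_flux σ he hf i j)
    (by norm_num) i

theorem gradInner_eq_zero_of_notMem_tsupport (σ : Metric M) {f : M → ℝ} (g : M → ℝ) {x : M}
    (hx : x ∉ tsupport f) : gradInner σ f g x = 0 := by
  have h0 : f =ᶠ[𝓝 x] fun _ => 0 := by
    filter_upwards [(isClosed_tsupport f).isOpen_compl.mem_nhds hx] with z hz
    exact image_eq_zero_of_notMem_tsupport hz
  rw [gradInner_eq_mfderiv, h0.mfderiv_eq, mfderiv_const]
  rfl

variable [T2Space M] [CompactSpace M]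

/-- The extension by zero of a function read in a chart. -/
theorem contDiff_indicator_comp_symm (he : e ∈ atlas Plane M) {f : M → ℝ} (hf : ContMDiff (𝓡 2) 𝓘(ℝ, ℝ) 1 f)
    (hs : tsupport f ⊆ e.source) :
    ContDiff ℝ 1 (e.target.indicator (f ∘ e.symm)) ∧
    HasCompactSupport (e.target.indicator (f ∘ e.symm)) ∧
    tsupport (e.target.indicator (f ∘ e.symm)) ⊆ e.target := by
  have hK : IsCompact (e '' tsupport f) :=
    (isClosed_tsupport f).isCompact.image_of_continuousOn (e.continuousOn.mono hs)
  have hsupp : Function.support (e.target.indicator (f ∘ e.symm)) ⊆ e '' tsupport f := by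
    intro y hy
    have hy' : y ∈ e.target := Set.mem_of_indicator_ne_zero hy
    refine ⟨e.symm y, subset_tsupport f ?_, e.right_inv hy'⟩
    rwa [Function.mem_support, indicator_of_mem hy'] at hy
  have hsub : e '' tsupport f ⊆ e.target := by
    rintro _ ⟨x, hx, rfl⟩
    exact e.map_source (hs hx)
  have hts : tsupport (e.target.indicator (f ∘ e.symm)) ⊆ e.target :=
    (closure_minimal hsupp hK.isClosed).trans hsub
  refine ⟨contMDiff_iff_contDiff.1 (contMDiff_of_tsupport fun y hy => ContDiffAt.contMDiffAt ?_),
    HasCompactSupport.of_support_subset_isCompact hK hsupp, hts⟩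
  refine ((contDiffOn_comp_symm he hf).contDiffAt
    (e.open_target.mem_nhds (hts hy))).congr_of_eventuallyEq ?_
  filter_upwards [e.open_target.mem_nhds (hts hy)] with z hz
  exact indicator_of_mem hz _

variable [MeasurableSpace M] [BorelSpace M]

theorem continuous_mul_laplacianIn (σ : Metric M) (he : e ∈ atlas Plane M) {f g : M → ℝ}
    (hf : Continuous f) (hs : tsupport f ⊆ e.source) (hg : ContMDiff (𝓡 2) 𝓘(ℝ, ℝ) 3 g) :
    Continuous fun x => f x * laplacianIn σ e g (e x) :=
  (hf.continuousOn.mul ((contDiffOn_laplacianIn σ he hg).continuousOn.comp e.continuousOn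
    e.mapsTo)).continuous_of_tsupport_subset e.open_source
    ((tsupport_mul_subset_left (f := f)).trans hs)

/-- Green's formula against a function supported in a chart. -/
theorem integral_gradInner_eq_of_tsupport (σ : Metric M) (he : e ∈ atlas Plane M) {f g : M → ℝ}
    (hf : ContMDiff (𝓡 2) 𝓘(ℝ, ℝ) 1 f) (hs : tsupport f ⊆ e.source)
    (hg : ContMDiff (𝓡 2) 𝓘(ℝ, ℝ) 3 g) :
    ∫ x, gradInner σ f g x ∂(area σ) = - ∫ x, f x * laplacianIn σ e g (e x) ∂(area σ) := by
  have hg1 : ContMDiff (𝓡 2) 𝓘(ℝ, ℝ) 1 g := hg.of_le (by norm_num)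
  obtain ⟨hψ, hc, hts⟩ := contDiff_indicator_comp_symm he hf hs
  set ψ := e.target.indicator (f ∘ e.symm) with hψd
  have hF := fun i j => (contDiffOn_flux σ he hg i j).of_le (one_le_two)
  set F : Fin 2 → Fin 2 → Plane → ℝ := fun i j z => areaDensity σ e z * (gram σ e z)⁻¹ i j *
      partialDeriv j (g ∘ e.symm) z with hFd
  have hI := fun i j => integral_mul_partialDeriv e.open_target hψ hc hts (hF i j) i
  rw [← setIntegral_eq_integral_of_forall_compl_eq_zero (s := e.source) (f := gradInner σ f g)
    fun x hx => gradInner_eq_zero_of_notMem_tsupport σ g fun h => hx (hs h),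
    ← setIntegral_eq_integral_of_forall_compl_eq_zero (s := e.source)
      (f := fun x => f x * laplacianIn σ e g (e x))
    fun x hx => by rw [image_eq_zero_of_notMem_tsupport fun h => hx (hs h), zero_mul],
    setIntegral_area σ he (continuous_gradInner σ hf hg1).measurable,
    setIntegral_area σ he (continuous_mul_laplacianIn σ he hf.continuous hs hg).measurable]
  have h1 : ∫ y in e.target, areaDensity σ e y * gradInner σ f g (e.symm y) =
      ∫ y, ∑ i, ∑ j, partialDeriv i ψ y * F i j y := by
    refine Eq.trans ?_ (setIntegral_eq_integral_of_forall_compl_eq_zero (s := e.target) ?_)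
    · refine setIntegral_congr_fun e.open_target.measurableSet fun y hy => ?_
      have hev : ψ =ᶠ[𝓝 y] f ∘ e.symm := by
        filter_upwards [e.open_target.mem_nhds hy] with z hz
        exact indicator_of_mem hz _
      have hpd : ∀ i, partialDeriv i ψ y = partialDeriv i (f ∘ e.symm) y := fun i => by
        rw [partialDeriv, hev.fderiv_eq, partialDeriv]
      simp only [hpd, gradInner_symm_apply σ he hy hf hg1, hFd, Finset.mul_sum]
      exact Finset.sum_congr rfl fun i _ => Finset.sum_congr rfl fun j _ => by ring
    · intro y hy
      have hy' : y ∉ tsupport ψ := fun h => hy (hts h)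
      have : ∀ i, partialDeriv i ψ y = 0 := fun i => by
        rw [partialDeriv, image_eq_zero_of_notMem_tsupport
          fun h => hy' (tsupport_fderiv_subset ℝ h)]
        rfl
      simp [this]
  -- The area density cancels the prefactor `1/√det σ` of the Laplacian, leaving `ψ` times the
  -- divergence of the flux `F`.
  have h2 : ∫ y in e.target, areaDensity σ e y * (f (e.symm y) * laplacianIn σ e g (e (e.symm y))) =
      ∫ y, ∑ i, ∑ j, ψ y * partialDeriv i (F i j) y := by
    refine Eq.trans ?_ (setIntegral_eq_integral_of_forall_compl_eq_zero (s := e.target) ?_)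
    · refine setIntegral_congr_fun e.open_target.measurableSet fun y hy => ?_
      have hD := (areaDensity_pos σ he hy).ne'
      simp only [← Finset.mul_sum, hψd, indicator_of_mem hy, Function.comp, laplacianIn,
        e.right_inv hy, hFd]
      field_simp
    · intro y hy
      simp [hψd, indicator_of_notMem hy]
  rw [h1, h2, integral_finsetSum, integral_finsetSum, ← Finset.sum_neg_distrib]
  · refine Finset.sum_congr rfl fun i _ => ?_
    rw [integral_finsetSum, integral_finsetSum, ← Finset.sum_neg_distrib]
    · exact Finset.sum_congr rfl fun j _ => by rw [(hI i j).2.2, neg_neg]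
    · exact fun j _ => (hI i j).1
    · exact fun j _ => (hI i j).2.1
  · exact fun i _ => integrable_finsetSum _ fun j _ => (hI i j).1
  · exact fun i _ => integrable_finsetSum _ fun j _ => (hI i j).2.1

theorem integrable_area_of_continuous (σ : Metric M) {f : M → ℝ} (hf : Continuous f) :
    Integrable f (area σ) :=
  hf.integrable_of_hasCompactSupport (HasCompactSupport.of_compactSpace f)

/-- The coordinate expression of the Laplacian does not depend on the chart. -/
theorem laplacianIn_eq (σ : Metric M) (he : e ∈ atlas Plane M) (he' : e' ∈ atlas Plane M)
    {g : M → ℝ} (hg : ContMDiff (𝓡 2) 𝓘(ℝ, ℝ) 3 g) {x : M} (hx : x ∈ e.source)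
    (hx' : x ∈ e'.source) : laplacianIn σ e g (e x) = laplacianIn σ e' g (e' x) := by
  have hU : IsOpen (e.source ∩ e'.source) := e.open_source.inter e'.open_source
  have hc : ∀ {e : OpenPartialHomeomorph M Plane}, e ∈ atlas Plane M →
      ContinuousOn (fun x => laplacianIn σ e g (e x)) e.source := fun {e} he =>
    (contDiffOn_laplacianIn σ he hg).continuousOn.comp e.continuousOn e.mapsTo
  have hc1 := (hc he).mono (inter_subset_left (t := e'.source))
  have hc2 := (hc he').mono (inter_subset_right (s := e.source))
  have := ChartedSpace.secondCountable_of_sigmaCompact Plane M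
  -- Test against functions supported in the overlap: by Green's formula in either chart both
  -- expressions have the same integral against `φ`, since `∫ ∇φ·∇g` involves no chart. Hence they
  -- agree almost everywhere, and then everywhere by continuity.
  have hae := hU.ae_eq_zero_of_integral_contMDiff_smul_eq_zero (𝓡 2) (μ := area σ)
    (f := fun x => laplacianIn σ e g (e x) - laplacianIn σ e' g (e' x))
    ((hc1.sub hc2).locallyIntegrableOn hU.measurableSet) (by
      intro φ hφ _ hφs
      have hφ1 : ContMDiff (𝓡 2) 𝓘(ℝ, ℝ) 1 φ := hφ.of_le (by simp)
      have h1 := integral_gradInner_eq_of_tsupport σ he hφ1 (hφs.trans inter_subset_left) hg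
      have h2 := integral_gradInner_eq_of_tsupport σ he' hφ1 (hφs.trans inter_subset_right) hg
      simp only [smul_eq_mul, mul_sub]
      rw [integral_sub]
      · linarith
      · exact integrable_area_of_continuous σ (continuous_mul_laplacianIn σ he hφ.continuous
          (hφs.trans inter_subset_left) hg)
      · exact integrable_area_of_continuous σ (continuous_mul_laplacianIn σ he' hφ.continuous
          (hφs.trans inter_subset_right) hg))
  have := Measure.eqOn_open_of_ae_eq (μ := area σ) (f := fun x => laplacianIn σ e g (e x))
    (g := fun x => laplacianIn σ e' g (e' x)) (by
      rw [Filter.EventuallyEq, ae_restrict_iff' hU.measurableSet]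
      filter_upwards [hae] with z hz hzU
      exact sub_eq_zero.1 (hz hzU)) hU hc1 hc2
  exact this ⟨hx, hx'⟩

theorem laplacian_eq_laplacianIn (σ : Metric M) (he : e ∈ atlas Plane M)
    {g : M → ℝ} (hg : ContMDiff (𝓡 2) 𝓘(ℝ, ℝ) 3 g) {x : M} (hx : x ∈ e.source) :
    laplacian σ g x = laplacianIn σ e g (e x) :=
  laplacianIn_eq σ (chart_mem_atlas Plane x) he hg (mem_chart_source Plane x) hx

/-- The chart in the definition of `laplacian` varies with the point, so regularity can be read off
only after passing to one fixed chart. -/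
theorem contMDiff_laplacian (σ : Metric M) {g : M → ℝ} (hg : ContMDiff (𝓡 2) 𝓘(ℝ, ℝ) 3 g) :
    ContMDiff (𝓡 2) 𝓘(ℝ, ℝ) 1 (laplacian σ g) := by
  refine contMDiff_of_contDiffOn_comp_symm (n := 1) fun e he => ?_
  refine (contDiffOn_laplacianIn σ he hg).congr fun y hy => ?_
  rw [Function.comp, laplacian_eq_laplacianIn σ he hg (e.map_target hy), e.right_inv hy]

/-- Green's formula on a closed surface. -/
theorem integral_gradInner_eq (σ : Metric M) {f g : M → ℝ}
    (hf : ContMDiff (𝓡 2) 𝓘(ℝ, ℝ) 1 f) (hg : ContMDiff (𝓡 2) 𝓘(ℝ, ℝ) 3 g) :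
    ∫ x, gradInner σ f g x ∂(area σ) = - ∫ x, f x * laplacian σ g x ∂(area σ) := by
  have hg1 : ContMDiff (𝓡 2) 𝓘(ℝ, ℝ) 1 g := hg.of_le (by norm_num)
  have hΔ := (contMDiff_laplacian σ hg).continuous
  have hfin : {p : M | (Function.support (chartPartition M p)).Nonempty}.Finite :=
    (chartPartition M).locallyFinite.finite_nonempty_of_compact
  have hρf : ∀ p, ContMDiff (𝓡 2) 𝓘(ℝ, ℝ) 1 fun x => chartPartition M p x * f x := fun p =>
    ((chartPartition M p).contMDiff.of_le (by simp)).mul hf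
  have hloc : ∀ p, ∫ x, gradInner σ (fun x => chartPartition M p x * f x) g x ∂(area σ) =
      - ∫ x, chartPartition M p x * f x * laplacian σ g x ∂(area σ) := by
    intro p
    have hts : tsupport (fun x => chartPartition M p x * f x) ⊆ (chartAt Plane p).source :=
      (tsupport_mul_subset_left (f := chartPartition M p)).trans
        (chartPartition_isSubordinate M p)
    rw [integral_gradInner_eq_of_tsupport σ (chart_mem_atlas Plane p) (hρf p) hts hg]
    congr 1
    refine integral_congr_ae (Filter.Eventually.of_forall fun x => ?_)
    dsimp only
    by_cases hx : x ∈ (chartAt Plane p).source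
    · rw [laplacian_eq_laplacianIn σ (chart_mem_atlas Plane p) hg hx]
    · rw [image_eq_zero_of_notMem_tsupport (f := fun x => chartPartition M p x * f x)
        fun h => hx (hts h), zero_mul, zero_mul]
  -- Both sides of Green's formula are additive in `f`, so the localized versions can be summed over
  -- any finite set of indices; the set `hfin.toFinset` then gives back `f`.
  have hsum : ∀ s : Finset M,
      ContMDiff (𝓡 2) 𝓘(ℝ, ℝ) 1 (fun x => ∑ p ∈ s, chartPartition M p x * f x) ∧
      ∫ x, gradInner σ (fun x => ∑ p ∈ s, chartPartition M p x * f x) g x ∂(area σ) =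
      - ∫ x, (∑ p ∈ s, chartPartition M p x * f x) * laplacian σ g x ∂(area σ) := by
    classical
    intro s
    induction s using Finset.induction_on with
    | empty =>
      refine ⟨by simpa using contMDiff_const, ?_⟩
      have : ∀ x, gradInner σ (fun _ => (0 : ℝ)) g x = 0 := fun x => by
        rw [gradInner_eq_mfderiv, mfderiv_const]
        rfl
      simp [this]
    | insert p s hp ih =>
      simp only [Finset.sum_insert hp]
      have hadd : ∀ x, gradInner σ (fun x => chartPartition M p x * f x +
          ∑ p ∈ s, chartPartition M p x * f x) g x =
          gradInner σ (fun x => chartPartition M p x * f x) g x +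
          gradInner σ (fun x => ∑ p ∈ s, chartPartition M p x * f x) g x := by
        intro x
        simp only [gradInner_eq_mfderiv]
        exact congrArg (fun L => L (grad σ g x)) (mfderiv_add
          ((hρf p).mdifferentiable (by simp) x) (ih.1.mdifferentiable (by simp) x))
      refine ⟨(hρf p).add ih.1, ?_⟩
      simp only [hadd, add_mul]
      rw [integral_add, integral_add, hloc p, ih.2, neg_add]
      · exact integrable_area_of_continuous σ ((hρf p).continuous.mul hΔ)
      · exact integrable_area_of_continuous σ (ih.1.continuous.mul hΔ)
      · exact integrable_area_of_continuous σ (continuous_gradInner σ (hρf p) hg1)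
      · exact integrable_area_of_continuous σ (continuous_gradInner σ ih.1 hg1)
  have hone : ∀ x, ∑ p ∈ hfin.toFinset, chartPartition M p x * f x = f x := by
    intro x
    have h1 := (chartPartition M).sum_eq_one (mem_univ x)
    rw [finsum_eq_sum_of_support_subset (s := hfin.toFinset) _
      fun p hp => hfin.mem_toFinset.2 ⟨x, hp⟩] at h1
    rw [← Finset.sum_mul, h1, one_mul]
  simpa only [hone] using (hsum hfin.toFinset).2

end GreenFormula

/-! ### The `L²`–`L¹` Sobolev–Poincaré inequality on a square. -/

section SquareSobolev

open Set Topology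

theorem enorm_sq_le_of_enorm_le {x : ℝ} {A B : ENNReal} (hA : ‖x‖ₑ ≤ A) (hB : ‖x‖ₑ ≤ B) :
    ‖x‖ₑ ^ 2 ≤ A * B := by
  rw [sq]
  exact mul_le_mul' hA hB

theorem enorm_sub_le_add {x y z : ℝ} : ‖x - z‖ₑ ≤ ‖x - y‖ₑ + ‖y - z‖ₑ := by
  rw [← sub_add_sub_cancel x y z]
  exact enorm_add_le _ _

/-- A Sobolev–Poincaré inequality on a product of two sets of the same length, for a function
whose oscillation along each line is controlled by a line integral. -/
theorem exists_setLIntegral_prod_enorm_sub_sq_le {I J : Set ℝ}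
    (hIJ : volume I = volume J) (h0 : volume I ≠ 0) (hfin : volume I ≠ ⊤)
    {v : ℝ × ℝ → ℝ} {p q : ℝ × ℝ → ENNReal} (hp : Measurable p) (hq : Measurable q)
    (hvp : ∀ s ∈ I, ∀ s' ∈ I, ∀ t ∈ J, ‖v (s, t) - v (s', t)‖ₑ ≤ ∫⁻ ξ in I, p (ξ, t))
    (hvq : ∀ s ∈ I, ∀ t ∈ J, ∀ t' ∈ J, ‖v (s, t) - v (s, t')‖ₑ ≤ ∫⁻ ξ in J, q (s, ξ)) :
    ∃ m : ℝ, ∫⁻ z in I ×ˢ J, ‖v z - m‖ₑ ^ 2 ≤ (∫⁻ z in I ×ˢ J, (p z + q z)) ^ 2 := by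
  set a : ℝ → ENNReal := fun t => ∫⁻ ξ in I, p (ξ, t) with ha
  set b : ℝ → ENNReal := fun s => ∫⁻ ξ in J, q (s, ξ) with hb
  have hma : Measurable a := hp.lintegral_prod_left'
  have hmb : Measurable b := hq.lintegral_prod_right'
  have hvol : (volume : Measure (ℝ × ℝ)).restrict (I ×ˢ J) =
      (volume.restrict I).prod (volume.restrict J) := by
    rw [Measure.prod_restrict]
    rfl
  -- Choose a vertical and a horizontal line whose line integrals do not exceed the average; the
  -- value at their crossing serves as the constant `m`.
  obtain ⟨s', hs', hbs⟩ := exists_le_setLAverage (f := b) h0 hfin hmb.aemeasurable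
  obtain ⟨t', ht', hat⟩ := exists_le_setLAverage (f := a) (hIJ ▸ h0) (hIJ ▸ hfin)
    hma.aemeasurable
  rw [setLAverage_eq] at hbs hat
  refine ⟨v (s', t'), ?_⟩
  have hA : ∫⁻ z in I ×ˢ J, p z = ∫⁻ t in J, a t := by
    rw [hvol, lintegral_prod_symm' _ hp]
  have hB : ∫⁻ z in I ×ˢ J, q z = ∫⁻ s in I, b s := by
    rw [hvol, lintegral_prod _ hq.aemeasurable]
  rw [lintegral_add_left hp, hA, hB]
  set A := ∫⁻ t in J, a t
  set B := ∫⁻ s in I, b s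
  calc ∫⁻ z in I ×ˢ J, ‖v z - v (s', t')‖ₑ ^ 2
      ≤ ∫⁻ z in I ×ˢ J, (b z.1 + a t') * (a z.2 + b s') := by
        -- Two rectangular paths join `z` to `(s', t')`, through `(z.1, t')` and through `(s',
        -- z.2)`. The first bound depends only on `z.1`, the second only on `z.2`, so their product
        -- integrates by Fubini.
        refine setLIntegral_mono (by fun_prop) fun z hz => ?_
        refine enorm_sq_le_of_enorm_le ?_ ?_
        · exact (enorm_sub_le_add (y := v (z.1, t'))).trans
            (add_le_add (hvq z.1 hz.1 z.2 hz.2 t' ht') (hvp z.1 hz.1 s' hs' t' ht'))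
        · exact (enorm_sub_le_add (y := v (s', z.2))).trans
            (add_le_add (hvp z.1 hz.1 s' hs' z.2 hz.2) (hvq s' hs' z.2 hz.2 t' ht'))
    _ = (B + a t' * volume I) * (A + b s' * volume J) := by
        rw [hvol, lintegral_prod_mul (f := fun s => b s + a t') (g := fun t => a t + b s')
          (by fun_prop) (by fun_prop), lintegral_add_right _ measurable_const,
          lintegral_add_right _ measurable_const, setLIntegral_const, setLIntegral_const]
    _ ≤ (B + A) * (A + B) := by
        gcongr
        · rw [hIJ]
          exact (mul_le_mul_left hat _).trans_eq (ENNReal.div_mul_cancel (hIJ ▸ h0) (hIJ ▸ hfin))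
        · rw [← hIJ]
          exact (mul_le_mul_left hbs _).trans_eq (ENNReal.div_mul_cancel h0 hfin)
    _ = (A + B) ^ 2 := by rw [sq, add_comm B A]

theorem enorm_sub_le_lintegral_partialDeriv {U : Set Plane} (hU : IsOpen U) {u : Plane → ℝ}
    (hu : ContDiffOn ℝ 1 u U) (i : Fin 2) (y : Plane) {I : Set ℝ} [I.OrdConnected]
    (hI : ∀ ξ ∈ I, y + ξ • (EuclideanSpace.single i (1 : ℝ) : Plane) ∈ U) {s s' : ℝ}
    (hs : s ∈ I) (hs' : s' ∈ I) :
    ‖u (y + s • EuclideanSpace.single i (1 : ℝ)) - u (y + s' • EuclideanSpace.single i (1 : ℝ))‖ₑ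
      ≤ ∫⁻ ξ in I, ‖partialDeriv i u (y + ξ • EuclideanSpace.single i (1 : ℝ))‖ₑ := by
  wlog h : s' ≤ s generalizing s s'
  · rw [← neg_sub, enorm_neg]
    exact this hs' hs (le_of_not_ge h)
  have hsub : Icc s' s ⊆ I := Set.OrdConnected.out ‹_› hs' hs
  have hline : ContDiff ℝ 1 fun ξ : ℝ => y + ξ • (EuclideanSpace.single i (1 : ℝ) : Plane) := by
    fun_prop
  have hd : ∀ ξ ∈ I, deriv (fun ξ : ℝ => u (y + ξ • (EuclideanSpace.single i (1 : ℝ) : Plane))) ξ =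
      partialDeriv i u (y + ξ • EuclideanSpace.single i (1 : ℝ)) := by
    intro ξ hξ
    have h1 : HasDerivAt (fun ξ : ℝ => y + ξ • (EuclideanSpace.single i (1 : ℝ) : Plane))
        ((1 : ℝ) • (EuclideanSpace.single i (1 : ℝ) : Plane)) ξ :=
      ((hasDerivAt_id ξ).smul_const _).const_add y
    have h2 := ((hu.contDiffAt (hU.mem_nhds (hI ξ hξ))).differentiableAt (by simp)).hasFDerivAt
    refine (h2.comp_hasDerivAt ξ h1).deriv.trans ?_
    rw [one_smul]
    rfl
  refine (enorm_sub_le_lintegral_deriv_of_contDiffOn_Icc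
    (f := fun ξ : ℝ => u (y + ξ • (EuclideanSpace.single i (1 : ℝ) : Plane)))
    (hu.comp hline.contDiffOn fun ξ hξ => hI ξ (hsub hξ)) h).trans ?_
  refine (setLIntegral_congr_fun measurableSet_Icc fun ξ hξ => ?_).trans_le
    (lintegral_mono_set hsub)
  rw [hd ξ (hsub hξ)]

/-- The open square with centre `c` and half side `r`. -/
def square (c : Plane) (r : ℝ) : Set Plane := {y | ∀ i, y i ∈ Ioo (c i - r) (c i + r)}

theorem isOpen_square (c : Plane) (r : ℝ) : IsOpen (square c r) := by
  simp only [square, ofPred_forall]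
  exact isOpen_iInter_of_finite fun i => isOpen_Ioo.preimage (by fun_prop)

theorem exists_square_subset {c : Plane} {U : Set Plane} (hU : U ∈ 𝓝 c) :
    ∃ r > 0, square c r ⊆ U := by
  obtain ⟨ε, hε, hball⟩ := Metric.mem_nhds_iff.1 hU
  refine ⟨ε / 2, half_pos hε, fun y hy => hball ?_⟩
  rw [Metric.mem_ball, EuclideanSpace.dist_eq, Real.sqrt_lt' hε, Fin.sum_univ_two]
  have h : ∀ i, dist (y i) (c i) ^ 2 < (ε / 2) ^ 2 := fun i => by
    have := hy i
    rw [Real.dist_eq, sq_abs]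
    exact sq_lt_sq' (by linarith [this.1]) (by linarith [this.2])
  nlinarith [h 0, h 1]

/-- The coordinates of the plane. -/
def planeEquiv : ℝ × ℝ ≃ᵐ Plane :=
  MeasurableEquiv.finTwoArrow.symm.trans (MeasurableEquiv.toLp 2 (Fin 2 → ℝ))

theorem measurePreserving_planeEquiv : MeasurePreserving planeEquiv :=
  (EuclideanSpace.volume_preserving_symm_measurableEquiv_toLp (Fin 2)).symm.comp
    (volume_preserving_finTwoArrow ℝ).symm

theorem planeEquiv_apply (z : ℝ × ℝ) : planeEquiv z = !₂[z.1, z.2] := rfl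

/-- The Sobolev–Poincaré inequality on a square of the plane. -/
theorem exists_setLIntegral_square_enorm_sub_sq_le {c : Plane} {r : ℝ} (hr : 0 < r)
    {u : Plane → ℝ} (hu : ContDiffOn ℝ 1 u (square c r)) :
    ∃ m : ℝ, ∫⁻ y in square c r, ‖u y - m‖ₑ ^ 2 ≤
      (∫⁻ y in square c r, (‖partialDeriv 0 u y‖ₑ + ‖partialDeriv 1 u y‖ₑ)) ^ 2 := by
  have hpd : ∀ i, Measurable fun y => ‖partialDeriv i u y‖ₑ := fun i =>
    (measurable_fderiv_apply_const ℝ u _).enorm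
  have hpre : planeEquiv ⁻¹' (square c r) =
      Ioo (c 0 - r) (c 0 + r) ×ˢ Ioo (c 1 - r) (c 1 + r) := by
    ext z
    simp [square, planeEquiv_apply, Fin.forall_fin_two]
  have hset : ∀ f : Plane → ENNReal, ∫⁻ z in Ioo (c 0 - r) (c 0 + r) ×ˢ Ioo (c 1 - r) (c 1 + r),
      f (planeEquiv z) = ∫⁻ y in square c r, f y := fun f => by
    rw [← hpre, measurePreserving_planeEquiv.setLIntegral_comp_preimage_emb
      planeEquiv.measurableEmbedding]
  have hl0 : ∀ s t : ℝ, planeEquiv (s, t) =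
      !₂[0, t] + s • (EuclideanSpace.single 0 (1 : ℝ) : Plane) := fun s t => by
    rw [planeEquiv_apply]
    ext j
    fin_cases j <;> simp
  have hl1 : ∀ s t : ℝ, planeEquiv (s, t) =
      !₂[s, 0] + t • (EuclideanSpace.single 1 (1 : ℝ) : Plane) := fun s t => by
    rw [planeEquiv_apply]
    ext j
    fin_cases j <;> simp
  have hmem : ∀ s ∈ Ioo (c 0 - r) (c 0 + r), ∀ t ∈ Ioo (c 1 - r) (c 1 + r),
      planeEquiv (s, t) ∈ square c r := fun s hs t ht => by
    rw [← mem_preimage, hpre]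
    exact ⟨hs, ht⟩
  obtain ⟨m, hm⟩ := exists_setLIntegral_prod_enorm_sub_sq_le
    (I := Ioo (c 0 - r) (c 0 + r)) (J := Ioo (c 1 - r) (c 1 + r))
    (v := fun z => u (planeEquiv z)) (p := fun z => ‖partialDeriv 0 u (planeEquiv z)‖ₑ)
    (q := fun z => ‖partialDeriv 1 u (planeEquiv z)‖ₑ) (by simp)
    (by simpa using hr) (by simp) ((hpd 0).comp planeEquiv.measurable)
    ((hpd 1).comp planeEquiv.measurable)
    (fun s hs s' hs' t ht => by
      simp only [hl0]
      exact enorm_sub_le_lintegral_partialDeriv (isOpen_square c r) hu 0 _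
        (fun ξ hξ => by rw [← hl0]; exact hmem ξ hξ t ht) hs hs')
    (fun s hs t ht t' ht' => by
      simp only [hl1]
      exact enorm_sub_le_lintegral_partialDeriv (isOpen_square c r) hu 1 _
        (fun ξ hξ => by rw [← hl1]; exact hmem s hs ξ hξ) ht ht')
  refine ⟨m, ?_⟩
  rwa [hset (fun y => ‖u y - m‖ₑ ^ 2),
    hset (fun y => ‖partialDeriv 0 u y‖ₑ + ‖partialDeriv 1 u y‖ₑ)] at hm

end SquareSobolev

/-! ### The Sobolev–Poincaré inequality on the whole surface. -/

section Sobolev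

open Set Topology

variable {M : Type*} [TopologicalSpace M] [ChartedSpace Plane M] [IsManifold (𝓡 2) ∞ M]
  {e : OpenPartialHomeomorph M Plane}

theorem inner_self_nonneg (σ : Metric M) {x : M} (v : TangentSpace (𝓡 2) x) :
    0 ≤ σ.inner x v v := by
  by_cases h : v = 0
  · simp [h]
  · exact (σ.pos x v h).le

/-- The Cauchy–Schwarz inequality for a Riemannian metric. -/
theorem inner_sq_le (σ : Metric M) {x : M} (v w : TangentSpace (𝓡 2) x) :
    σ.inner x v w ^ 2 ≤ σ.inner x v v * σ.inner x w w := by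
  have h : ∀ t : ℝ, 0 ≤ σ.inner x w w * (t * t) + 2 * σ.inner x v w * t + σ.inner x v v := by
    intro t
    have := inner_self_nonneg σ (v + t • w)
    simp only [map_add, map_smul, add_apply, smul_apply, smul_eq_mul] at this
    rw [σ.symm x w v] at this
    linarith
  have := discrim_le_zero h
  rw [discrim] at this
  linarith

/-- The length `|∇f|` of the gradient. -/
noncomputable def gradNorm (σ : Metric M) (f : M → ℝ) (x : M) : ℝ := √(gradInner σ f f x)

theorem gradNorm_nonneg (σ : Metric M) (f : M → ℝ) (x : M) : 0 ≤ gradNorm σ f x :=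
  Real.sqrt_nonneg _

theorem gradNorm_sq (σ : Metric M) (f : M → ℝ) (x : M) :
    gradNorm σ f x ^ 2 = gradInner σ f f x :=
  Real.sq_sqrt (inner_self_nonneg σ _)

theorem continuous_gradNorm (σ : Metric M) {f : M → ℝ} (hf : ContMDiff (𝓡 2) 𝓘(ℝ, ℝ) 1 f) :
    Continuous (gradNorm σ f) :=
  (continuous_gradInner σ hf hf).sqrt

theorem abs_inner_grad_le (σ : Metric M) (f : M → ℝ) {x : M} (v : TangentSpace (𝓡 2) x) :
    |σ.inner x v (grad σ f x)| ≤ √(σ.inner x v v) * gradNorm σ f x := by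
  rw [gradNorm, ← Real.sqrt_mul (inner_self_nonneg σ v)]
  exact Real.abs_le_sqrt (inner_sq_le σ v _)

theorem abs_partialDeriv_le (σ : Metric M) (he : e ∈ atlas Plane M) {f : M → ℝ}
    (hf : ContMDiff (𝓡 2) 𝓘(ℝ, ℝ) 1 f) {y : Plane} (hy : y ∈ e.target) (i : Fin 2) :
    |partialDeriv i (f ∘ e.symm) y| ≤ √(gram σ e y i i) * gradNorm σ f (e.symm y) := by
  rw [← mfderiv_coordVec he hy (hf.mdifferentiable (by simp) _) i, ← inner_grad σ f, σ.symm]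
  exact abs_inner_grad_le σ f (coordVec e i y)

variable [T2Space M] [CompactSpace M] [MeasurableSpace M] [BorelSpace M]

/-- The local Sobolev–Poincaré inequality on a surface. -/
theorem exists_nhds_setLIntegral_enorm_sub_sq_le (σ : Metric M) (x : M) :
    ∃ U : Set M, IsOpen U ∧ x ∈ U ∧ ∃ C : ENNReal, C ≠ ⊤ ∧ ∀ f : M → ℝ,
      ContMDiff (𝓡 2) 𝓘(ℝ, ℝ) 1 f → ∃ m : ℝ, ∫⁻ z in U, ‖f z - m‖ₑ ^ 2 ∂(area σ) ≤
        C * (∫⁻ z, ‖gradNorm σ f z‖ₑ ∂(area σ)) ^ 2 := by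
  set e := chartAt Plane x
  have he : e ∈ atlas Plane M := chart_mem_atlas Plane x
  have hx : x ∈ e.source := mem_chart_source Plane x
  have hy : e x ∈ e.target := e.map_source hx
  have hct : ∀ {g : Plane → ℝ}, ContDiffOn ℝ ∞ g e.target → ContinuousAt g (e x) := fun hg =>
    hg.continuousOn.continuousAt (e.open_target.mem_nhds hy)
  have hD := hct (contDiffOn_areaDensity σ he)
  have hDpos := areaDensity_pos σ he hy
  set D₀ := areaDensity σ e (e x)
  set c : ℝ := max (gram σ e (e x) 0 0) (gram σ e (e x) 1 1) + 1 with hc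
  -- On a small square the density lies between `D₀ / 2` and `D₀ + 1` and the diagonal Gram entries
  -- are below `c`, so planar and Riemannian quantities are comparable with constants independent of
  -- `f`.
  obtain ⟨r, hr, hsq⟩ := exists_square_subset (c := e x) (Filter.inter_mem
    (e.open_target.mem_nhds hy) (Filter.inter_mem
      (Filter.inter_mem (hD.eventually_lt continuousAt_const (lt_add_one D₀))
        (continuousAt_const.eventually_lt hD (half_lt_self hDpos)))
      (Filter.inter_mem ((hct (contDiffOn_gram σ he 0 0)).eventually_lt continuousAt_const
          (show _ < c by rw [hc]; exact (le_max_left _ _).trans_lt (lt_add_one _)))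
        ((hct (contDiffOn_gram σ he 1 1)).eventually_lt continuousAt_const
          (show _ < c by rw [hc]; exact (le_max_right _ _).trans_lt (lt_add_one _))))))
  set Q := square (e x) r with hQ
  have hQt : Q ⊆ e.target := fun y hy => (hsq hy).1
  have hQm : MeasurableSet Q := (isOpen_square _ _).measurableSet
  have hxQ : e x ∈ Q := fun i => ⟨by linarith, by linarith⟩
  have hU : IsOpen (e.source ∩ e ⁻¹' Q) := e.isOpen_inter_preimage (isOpen_square _ _)
  have hUQ : e.target ∩ e.symm ⁻¹' (e.source ∩ e ⁻¹' Q) = Q := by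
    ext y
    constructor
    · rintro ⟨hy, -, hy'⟩
      rwa [mem_preimage, e.right_inv hy] at hy'
    · intro hy
      refine ⟨hQt hy, e.map_target (hQt hy), ?_⟩
      rwa [mem_preimage, e.right_inv (hQt hy)]
  have hint : ∀ g : M → ENNReal, Measurable g → ∫⁻ z in e.source ∩ e ⁻¹' Q, g z ∂(area σ) =
      ∫⁻ y in Q, ENNReal.ofReal (areaDensity σ e y) * g (e.symm y) := fun g hg => by
    rw [setLIntegral_area σ he hg hU.measurableSet inter_subset_left, hUQ]
  -- Each of the two partial derivatives is at most `√c |∇f|`, and `dy` costs a factor `1 / (D₀ /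
  -- 2)` against the area measure.
  set K : ENNReal := ENNReal.ofReal (2 * √c / (D₀ / 2)) with hK
  refine ⟨e.source ∩ e ⁻¹' Q, hU, ⟨hx, hxQ⟩, ENNReal.ofReal (D₀ + 1) * K ^ 2,
    ENNReal.mul_ne_top ENNReal.ofReal_ne_top (ENNReal.pow_ne_top ENNReal.ofReal_ne_top),
    fun f hf => ?_⟩
  have hu := (contDiffOn_comp_symm he hf).mono hQt
  obtain ⟨m, hm⟩ := exists_setLIntegral_square_enorm_sub_sq_le hr hu
  refine ⟨m, ?_⟩
  have hgn : Measurable fun z => ‖gradNorm σ f z‖ₑ := (continuous_gradNorm σ hf).measurable.enorm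
  have hgrad : ∫⁻ y in Q, (‖partialDeriv 0 (f ∘ e.symm) y‖ₑ + ‖partialDeriv 1 (f ∘ e.symm) y‖ₑ) ≤
      K * ∫⁻ z, ‖gradNorm σ f z‖ₑ ∂(area σ) := by
    calc _ ≤ ∫⁻ y in Q, K * (ENNReal.ofReal (areaDensity σ e y) * ‖gradNorm σ f (e.symm y)‖ₑ) := by
          refine setLIntegral_mono' hQm fun y hy => ?_
          obtain ⟨hyt, ⟨-, hy2⟩, hy3, hy4⟩ := hsq hy
          have hg := gradNorm_nonneg σ f (e.symm y)
          have hpd : ∀ i, gram σ e y i i < c →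
              |partialDeriv i (f ∘ e.symm) y| ≤ √c * gradNorm σ f (e.symm y) := fun i hi =>
            (abs_partialDeriv_le σ he hf hyt i).trans
              (mul_le_mul_of_nonneg_right (Real.sqrt_le_sqrt hi.le) hg)
          rw [Real.enorm_eq_ofReal_abs, Real.enorm_eq_ofReal_abs, Real.enorm_eq_ofReal hg, hK,
            ← ENNReal.ofReal_add (abs_nonneg _) (abs_nonneg _),
            ← ENNReal.ofReal_mul (areaDensity_pos σ he hyt).le,
            ← ENNReal.ofReal_mul (by positivity)]
          refine ENNReal.ofReal_le_ofReal ?_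
          have h1 : 1 ≤ areaDensity σ e y / (D₀ / 2) := by
            rw [one_le_div (by positivity)]
            exact le_of_lt hy2
          calc _ ≤ 2 * √c * gradNorm σ f (e.symm y) * 1 := by
                linarith [hpd 0 hy3, hpd 1 hy4]
            _ ≤ 2 * √c * gradNorm σ f (e.symm y) * (areaDensity σ e y / (D₀ / 2)) := by gcongr
            _ = _ := by ring
      _ = K * ∫⁻ z in e.source ∩ e ⁻¹' Q, ‖gradNorm σ f z‖ₑ ∂(area σ) := by
          rw [lintegral_const_mul' _ _ ENNReal.ofReal_ne_top, hint _ hgn]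
      _ ≤ _ := by
          gcongr
          exact Measure.restrict_le_self
  calc ∫⁻ z in e.source ∩ e ⁻¹' Q, ‖f z - m‖ₑ ^ 2 ∂(area σ)
      = ∫⁻ y in Q, ENNReal.ofReal (areaDensity σ e y) * ‖f (e.symm y) - m‖ₑ ^ 2 :=
        hint _ ((hf.continuous.measurable.sub_const m).enorm.pow_const 2)
    _ ≤ ∫⁻ y in Q, ENNReal.ofReal (D₀ + 1) * ‖(f ∘ e.symm) y - m‖ₑ ^ 2 := by
        refine setLIntegral_mono' hQm fun y hy => ?_
        have := (hsq hy).2.1.1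
        exact mul_le_mul_left (ENNReal.ofReal_le_ofReal (le_of_lt this)) _
    _ = ENNReal.ofReal (D₀ + 1) * ∫⁻ y in Q, ‖(f ∘ e.symm) y - m‖ₑ ^ 2 :=
        lintegral_const_mul' _ _ ENNReal.ofReal_ne_top
    _ ≤ ENNReal.ofReal (D₀ + 1) * (K * ∫⁻ z, ‖gradNorm σ f z‖ₑ ∂(area σ)) ^ 2 := by
        gcongr
        exact hm.trans (by gcongr)
    _ = _ := by rw [mul_pow, mul_assoc]

theorem enorm_sub_sq_le (a b c : ℝ) : ‖a - c‖ₑ ^ 2 ≤ 2 * ‖a - b‖ₑ ^ 2 + 2 * ‖b - c‖ₑ ^ 2 := by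
  have h : ∀ t : ℝ, ‖t‖ₑ ^ 2 = ENNReal.ofReal (t ^ 2) := fun t => by
    rw [Real.enorm_eq_ofReal_abs, ← ENNReal.ofReal_pow (abs_nonneg t), sq_abs]
  have h2 : (2 : ENNReal) = ENNReal.ofReal 2 := by simp
  rw [h, h, h, h2, ← ENNReal.ofReal_mul (by norm_num), ← ENNReal.ofReal_mul (by norm_num),
    ← ENNReal.ofReal_add (by positivity) (by positivity)]
  refine ENNReal.ofReal_le_ofReal ?_
  nlinarith [sq_nonneg (a - b - (b - c))]

/-- The Sobolev–Poincaré inequality `‖f - m‖_{L²} ≤ C ‖∇f‖_{L¹}` on a closed surface. -/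
theorem exists_lintegral_enorm_sub_sq_le [ConnectedSpace M] (σ : Metric M) :
    ∃ C : ENNReal, C ≠ ⊤ ∧ ∀ f : M → ℝ, ContMDiff (𝓡 2) 𝓘(ℝ, ℝ) 1 f →
      ∃ m : ℝ, ∫⁻ z, ‖f z - m‖ₑ ^ 2 ∂(area σ) ≤
        C * (∫⁻ z, ‖gradNorm σ f z‖ₑ ∂(area σ)) ^ 2 := by
  choose U hUo hxU C hC m hm using exists_nhds_setLIntegral_enorm_sub_sq_le σ
  obtain ⟨x₀⟩ : Nonempty M := inferInstance
  set G : (M → ℝ) → ENNReal := fun f => (∫⁻ z, ‖gradNorm σ f z‖ₑ ∂(area σ)) ^ 2 with hG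
  -- The constant is the one attached to the fixed point `x₀`, whatever `s` is, and `K` must not
  -- depend on `f`.
  let P : Set M → Prop := fun s => ∃ K : ENNReal, K ≠ ⊤ ∧ ∀ (f : M → ℝ)
    (hf : ContMDiff (𝓡 2) 𝓘(ℝ, ℝ) 1 f), ∫⁻ z in s, ‖f z - m x₀ f hf‖ₑ ^ 2 ∂(area σ) ≤ K * G f
  have hmeas : ∀ (f : M → ℝ) (a : ℝ), ContMDiff (𝓡 2) 𝓘(ℝ, ℝ) 1 f →
      Measurable fun z => ‖f z - a‖ₑ ^ 2 := fun f a hf =>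
    (hf.continuous.measurable.sub_const a).enorm.pow_const 2
  have htri : ∀ (f : M → ℝ), ContMDiff (𝓡 2) 𝓘(ℝ, ℝ) 1 f → ∀ (a b : ℝ) (s : Set M),
      ∫⁻ z in s, ‖f z - b‖ₑ ^ 2 ∂(area σ) ≤ 2 * ∫⁻ z in s, ‖f z - a‖ₑ ^ 2 ∂(area σ)
        + 2 * ‖a - b‖ₑ ^ 2 * area σ s := by
    intro f hf a b s
    rw [← lintegral_const_mul' _ _ (by simp), ← setLIntegral_const,
      ← lintegral_add_right _ measurable_const]
    exact lintegral_mono fun z => enorm_sub_sq_le (f z) a b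
  have hdiff : ∀ (f : M → ℝ), ContMDiff (𝓡 2) 𝓘(ℝ, ℝ) 1 f → ∀ (a b : ℝ) (s : Set M),
      ‖a - b‖ₑ ^ 2 * area σ s ≤ 2 * ∫⁻ z in s, ‖f z - a‖ₑ ^ 2 ∂(area σ)
        + 2 * ∫⁻ z in s, ‖f z - b‖ₑ ^ 2 ∂(area σ) := by
    intro f hf a b s
    rw [← lintegral_const_mul' _ _ (by simp), ← lintegral_const_mul' _ _ (by simp),
      ← setLIntegral_const, ← lintegral_add_right _ ((hmeas f b hf).const_mul 2)]
    refine lintegral_mono fun z => (enorm_sub_sq_le a (f z) b).trans_eq ?_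
    rw [← neg_sub a, enorm_neg]
  -- For closedness, let `U x` meet a good open set `s`. The overlap has positive area, and
  -- comparing `f` there with both constants bounds `|m x - m x₀|²` by a multiple of `G f`; the
  -- local inequality then holds on `U x` with `m x₀`.
  have hclopen : IsClopen {x : M | ∃ s, IsOpen s ∧ x ∈ s ∧ P s} := by
    constructor
    · refine isClosed_of_closure_subset fun x hx => ?_
      obtain ⟨y, hyU, s, hso, hys, K, hK, hs⟩ := mem_closure_iff.1 hx (U x) (hUo x) (hxU x)
      have hVpos : area σ (U x ∩ s) ≠ 0 :=
        (((hUo x).inter hso).measure_pos (area σ) ⟨y, hyU, hys⟩).ne'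
      refine ⟨U x, hUo x, hxU x, 2 * C x + 2 * ((2 * C x + 2 * K) / area σ (U x ∩ s)) * area σ (U x),
        ?_, fun f hf => ?_⟩
      · have h2 : (2 : ENNReal) ≠ ⊤ := by simp
        refine ENNReal.add_ne_top.2 ⟨ENNReal.mul_ne_top h2 (hC x), ENNReal.mul_ne_top
          (ENNReal.mul_ne_top h2 (ENNReal.div_ne_top (ENNReal.add_ne_top.2
            ⟨ENNReal.mul_ne_top h2 (hC x), ENNReal.mul_ne_top h2 hK⟩) hVpos)) (measure_ne_top _ _)⟩
      · have h1 : ‖m x f hf - m x₀ f hf‖ₑ ^ 2 ≤ (2 * C x + 2 * K) / area σ (U x ∩ s) * G f := by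
          rw [← ENNReal.mul_div_right_comm, ENNReal.le_div_iff_mul_le (.inl hVpos)
            (.inl (measure_ne_top _ _))]
          refine (hdiff f hf _ _ _).trans ?_
          rw [add_mul, mul_assoc, mul_assoc]
          gcongr
          · exact (lintegral_mono_set inter_subset_left).trans (hm x f hf)
          · exact (lintegral_mono_set inter_subset_right).trans (hs f hf)
        refine (htri f hf (m x f hf) _ _).trans ?_
        calc _ ≤ 2 * (C x * G f) + 2 * ((2 * C x + 2 * K) / area σ (U x ∩ s) * G f)
              * area σ (U x) := by
              gcongr
              exact hm x f hf
          _ = _ := by ring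
    · rw [isOpen_iff_mem_nhds]
      rintro x ⟨s, hso, hxs, hs⟩
      exact Filter.mem_of_superset (hso.mem_nhds hxs) fun y hy => ⟨s, hso, hy, hs⟩
  have huniv := hclopen.eq_univ ⟨x₀, U x₀, hUo x₀, hxU x₀, C x₀, hC x₀, hm x₀⟩
  -- Connectedness gives every point a good neighbourhood; `P` passes to subsets and finite unions,
  -- so compactness yields it on the whole surface.
  have hP : P univ := by
    refine isCompact_univ.induction_on (p := P) ⟨0, by simp, by simp⟩ ?_ ?_ ?_
    · rintro s t hst ⟨K, hK, ht⟩
      exact ⟨K, hK, fun f hf => (lintegral_mono_set hst).trans (ht f hf)⟩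
    · rintro s t ⟨K, hK, hs⟩ ⟨L, hL, ht⟩
      refine ⟨K + L, ENNReal.add_ne_top.2 ⟨hK, hL⟩, fun f hf => ?_⟩
      rw [add_mul]
      exact (lintegral_union_le _ _ _).trans (add_le_add (hs f hf) (ht f hf))
    · intro x _
      obtain ⟨s, hso, hxs, hs⟩ : x ∈ {x : M | ∃ s, IsOpen s ∧ x ∈ s ∧ P s} := huniv ▸ mem_univ x
      exact ⟨s, mem_nhdsWithin_of_mem_nhds (hso.mem_nhds hxs), hs⟩
  obtain ⟨K, hK, h⟩ := hP
  refine ⟨K, hK, fun f hf => ⟨m x₀ f hf, ?_⟩⟩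
  simpa using h f hf

end Sobolev

/-! ### The `L¹` bound of the gradient by the Laplacian. -/

section GradientEstimate

open Set Topology

variable {M : Type*} [TopologicalSpace M] [ChartedSpace Plane M] [IsManifold (𝓡 2) ∞ M]

theorem gradInner_comm (σ : Metric M) (f g : M → ℝ) (x : M) :
    gradInner σ f g x = gradInner σ g f x :=
  σ.symm x _ _

theorem gradInner_comp (σ : Metric M) {φ : ℝ → ℝ} {φ' : ℝ} {f : M → ℝ} (g : M → ℝ) {x : M}
    (hφ : HasDerivAt φ φ' (f x)) (hf : MDifferentiableAt (𝓡 2) 𝓘(ℝ, ℝ) f x) :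
    gradInner σ (φ ∘ f) g x = φ' * gradInner σ f g x := by
  have h := mfderiv_comp (I' := 𝓘(ℝ, ℝ)) x hφ.differentiableAt.mdifferentiableAt hf
  rw [gradInner_eq_mfderiv, gradInner_eq_mfderiv, h, mfderiv_eq_fderiv]
  have h2 : ∀ t : ℝ, fderiv ℝ φ (f x) t = φ' * t := fun t => by
    rw [hφ.hasFDerivAt.fderiv]
    simp [mul_comm]
  exact h2 _

variable [T2Space M] [CompactSpace M] [MeasurableSpace M] [BorelSpace M]

theorem ofReal_integral_eq_lintegral_enorm (σ : Metric M) {f : M → ℝ} (hf : Continuous f)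
    (h0 : ∀ x, 0 ≤ f x) :
    ENNReal.ofReal (∫ x, f x ∂(area σ)) = ∫⁻ x, ‖f x‖ₑ ∂(area σ) := by
  rw [← ofReal_integral_norm_eq_lintegral_enorm (integrable_area_of_continuous σ hf)]
  simp only [Real.norm_eq_abs, abs_of_nonneg (h0 _)]

theorem exists_integral_sub_sq_le [ConnectedSpace M] (σ : Metric M) :
    ∃ C : ℝ, 0 ≤ C ∧ ∀ f : M → ℝ, ContMDiff (𝓡 2) 𝓘(ℝ, ℝ) 1 f →
      ∃ m : ℝ, ∫ x, (f x - m) ^ 2 ∂(area σ) ≤ C * (∫ x, gradNorm σ f x ∂(area σ)) ^ 2 := by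
  obtain ⟨C, hC, h⟩ := exists_lintegral_enorm_sub_sq_le σ
  refine ⟨C.toReal, ENNReal.toReal_nonneg, fun f hf => ?_⟩
  obtain ⟨m, hm⟩ := h f hf
  have hG : 0 ≤ ∫ x, gradNorm σ f x ∂(area σ) := integral_nonneg fun x => gradNorm_nonneg σ f x
  have hc : Continuous fun x => (f x - m) ^ 2 := (hf.continuous.sub continuous_const).pow 2
  refine ⟨m, ?_⟩
  rw [← ENNReal.ofReal_le_ofReal_iff (by positivity), ENNReal.ofReal_mul ENNReal.toReal_nonneg,
    ENNReal.ofReal_toReal hC, ENNReal.ofReal_pow hG,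
    ofReal_integral_eq_lintegral_enorm σ (continuous_gradNorm σ hf) (gradNorm_nonneg σ f),
    ofReal_integral_eq_lintegral_enorm σ hc fun x => sq_nonneg _]
  simpa only [enorm_pow] using hm

/-- The estimate `‖∇f‖_{L¹} ≤ C ‖Δf‖_{L¹}` on a closed surface. -/
theorem exists_integral_gradNorm_le [ConnectedSpace M] (σ : Metric M) :
    ∃ C : ℝ, 0 ≤ C ∧ ∀ f : M → ℝ, ContMDiff (𝓡 2) 𝓘(ℝ, ℝ) 3 f →
      ∫ x, gradNorm σ f x ∂(area σ) ≤ C * ∫ x, |laplacian σ f x| ∂(area σ) := by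
  obtain ⟨C, hC, h⟩ := exists_integral_sub_sq_le σ
  set A := (area σ).real univ with hA
  have hA0 : 0 ≤ A := measureReal_nonneg
  -- `A + C` is what the final absorption requires; the added `1` makes `l` positive.
  set l := A + C + 1 with hl
  have hl0 : 0 < l := by positivity
  clear_value l
  clear_value A
  refine ⟨2 * l, by positivity, fun f hf => ?_⟩
  have hf1 : ContMDiff (𝓡 2) 𝓘(ℝ, ℝ) 1 f := hf.of_le (by norm_num)
  obtain ⟨m, hm⟩ := h f hf1
  set s := ∫ x, gradNorm σ f x ∂(area σ) with hs
  set L := ∫ x, |laplacian σ f x| ∂(area σ) with hL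
  have hL0 : 0 ≤ L := integral_nonneg fun x => abs_nonneg _
  have hΔ := (contMDiff_laplacian σ hf).continuous
  have hs00 : 0 ≤ s := integral_nonneg fun x => gradNorm_nonneg σ f x
  clear_value s L
  rcases hs00.eq_or_lt with hs0 | hs0
  · rw [← hs0]
    positivity
  -- A bounded test function at the scale `s = ‖∇f‖₁`: its bound does not depend on `f`, while its
  -- derivative `s / (s² + (t - m)²)` is the weight needed below.
  set a : ℝ → ℝ := fun t => Real.arctan ((t - m) / s) with ha
  have haC : ContDiff ℝ 1 a :=
    Real.contDiff_arctan.comp ((contDiff_id.sub contDiff_const).div_const s)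
  have hφ : ContMDiff (𝓡 2) 𝓘(ℝ, ℝ) 1 (a ∘ f) := haC.contMDiff.comp hf1
  have hda : ∀ t, HasDerivAt a (s / (s ^ 2 + (t - m) ^ 2)) t := fun t => by
    have h1 : HasDerivAt a (1 / (1 + ((t - m) / s) ^ 2) * (1 / s)) t :=
      (((hasDerivAt_id t).sub_const m).div_const s).arctan
    have h2 : 0 < s ^ 2 + (t - m) ^ 2 := by positivity
    have h3 : 1 / (1 + ((t - m) / s) ^ 2) * (1 / s) = s / (s ^ 2 + (t - m) ^ 2) := by
      field_simp
    rwa [h3] at h1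
  have hgreen : ∫ x, gradInner σ (a ∘ f) f x ∂(area σ) ≤ 2 * L := by
    rw [integral_gradInner_eq σ hφ hf, ← integral_neg, hL, ← integral_const_mul]
    refine integral_mono (integrable_area_of_continuous σ (hφ.continuous.mul hΔ).neg)
      (integrable_area_of_continuous σ (hΔ.abs.const_mul 2)) fun x => ?_
    have h1 : |(a ∘ f) x| ≤ 2 := by
      have h2 := Real.neg_pi_div_two_lt_arctan ((f x - m) / s)
      have h3 := Real.arctan_lt_pi_div_two ((f x - m) / s)
      rw [abs_le]
      constructor <;> simp only [ha, Function.comp] <;> linarith [Real.pi_le_four]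
    calc -((a ∘ f) x * laplacian σ f x) ≤ |(a ∘ f) x * laplacian σ f x| := neg_le_abs _
      _ = |(a ∘ f) x| * |laplacian σ f x| := abs_mul _ _
      _ ≤ 2 * |laplacian σ f x| := by gcongr
  -- Young's inequality with parameter `l`: the difference of the two sides is a perfect square over
  -- a positive quantity.
  have hpt : ∀ x, gradNorm σ f x ≤ l / 2 * gradInner σ (a ∘ f) f x +
      1 / (2 * l * s) * (s ^ 2 + (f x - m) ^ 2) := by
    intro x
    have hk : 0 < s ^ 2 + (f x - m) ^ 2 := by positivity
    rw [gradInner_comp σ f (hda (f x)) (hf.mdifferentiable (by simp) x), ← gradNorm_sq]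
    generalize gradNorm σ f x = g
    generalize s ^ 2 + (f x - m) ^ 2 = k at hk ⊢
    have h1 : l / 2 * (s / k * g ^ 2) + 1 / (2 * l * s) * k - g =
        (l * s * g - k) ^ 2 / (2 * l * s * k) := by
      field_simp
      ring
    have h2 : 0 ≤ (l * s * g - k) ^ 2 / (2 * l * s * k) := by positivity
    linarith
  have hc1 := continuous_gradInner σ hφ hf1
  have hc2 : Continuous fun x => (f x - m) ^ 2 := (hf.continuous.sub continuous_const).pow 2
  have hi0 := integrable_area_of_continuous σ (continuous_gradNorm σ hf1)
  have hi1 : Integrable (fun x => l / 2 * gradInner σ (a ∘ f) f x) (area σ) :=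
    (integrable_area_of_continuous σ hc1).const_mul (l / 2)
  have hi2 := integrable_area_of_continuous σ hc2
  have hi3 : Integrable (fun _ : M => s ^ 2) (area σ) := integrable_const _
  have hi4 : Integrable (fun x => 1 / (2 * l * s) * (s ^ 2 + (f x - m) ^ 2)) (area σ) :=
    (hi3.add hi2).const_mul _
  have hint : s ≤ l / 2 * ∫ x, gradInner σ (a ∘ f) f x ∂(area σ) +
      1 / (2 * l * s) * (A * s ^ 2 + ∫ x, (f x - m) ^ 2 ∂(area σ)) := by
    have h1 := integral_mono hi0 (hi1.add hi4) hpt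
    rw [← hs] at h1
    refine h1.trans_eq ?_
    simp only [Pi.add_apply]
    rw [integral_add hi1 hi4, integral_const_mul, integral_const_mul,
      integral_add hi3 hi2, integral_const, smul_eq_mul, hA]
  -- The Sobolev–Poincaré bound makes the bracket at most `(A + C) s² ≤ l s²`, so this term can be
  -- absorbed into the left side `s`.
  have h1 : 1 / (2 * l * s) * (A * s ^ 2 + ∫ x, (f x - m) ^ 2 ∂(area σ)) ≤ s / 2 := by
    rw [one_div_mul_eq_div, div_le_div_iff₀ (by positivity) two_pos]
    nlinarith [mul_pos hs0 hs0]
  have h2 : l / 2 * ∫ x, gradInner σ (a ∘ f) f x ∂(area σ) ≤ l * L := by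
    calc _ ≤ l / 2 * (2 * L) := by gcongr
      _ = l * L := by ring
  linarith

end GradientEstimate

/-! ### Continuity and boundedness of the connection form on gradients. -/

section OneForm

open Set Topology

variable {M : Type*} [TopologicalSpace M] [ChartedSpace Plane M] [IsManifold (𝓡 2) ∞ M]
  {α : (x : M) → TangentSpace (𝓡 2) x →L[ℝ] ℝ}

theorem continuous_oneForm_grad (σ : Metric M) (hα : IsC1OneForm α) {f : M → ℝ}
    (hf : ContMDiff (𝓡 2) 𝓘(ℝ, ℝ) 1 f) : Continuous fun x => α x (grad σ f x) := by
  refine (contMDiff_of_contDiffOn_comp_symm (n := 0) fun e he => ?_).continuous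
  refine contDiffOn_zero.2 (ContinuousOn.congr (f := fun y => ∑ i, ∑ j, (gram σ e y)⁻¹ i j *
    α (e.symm y) (coordVec e i y) * partialDeriv j (f ∘ e.symm) y) ?_ fun y hy =>
      apply_grad σ he hy (hf.mdifferentiable (by simp) _) (α (e.symm y)))
  exact continuousOn_finsetSum _ fun i _ => continuousOn_finsetSum _ fun j _ =>
    ((contDiffOn_gram_inv σ he i j).continuousOn.mul
      (continuousOn_oneForm_coordVec hα he i)).mul
      (contDiffOn_partialDeriv (m := 0) (n := 1) e.open_target (contDiffOn_comp_symm he hf)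
        (by simp) j).continuousOn

/-- If `X` is the vector field dual to `α`, then `|X|² = α(X)` is continuous, hence bounded on the
compact surface, and Cauchy–Schwarz applies to `σ(X, ∇f)`. -/
theorem exists_abs_oneForm_grad_le [CompactSpace M] (σ : Metric M) (hα : IsC1OneForm α) :
    ∃ a : ℝ, 0 ≤ a ∧ ∀ (f : M → ℝ) (x : M), |α x (grad σ f x)| ≤ a * gradNorm σ f x := by
  choose X hX using fun x => (existsUnique_sharp σ x (α x)).exists
  have hc : Continuous fun x => α x (X x) := by
    refine (contMDiff_of_contDiffOn_comp_symm (n := 0) fun e he => ?_).continuous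
    refine contDiffOn_zero.2 (ContinuousOn.congr (f := fun y => ∑ i, (∑ j, (gram σ e y)⁻¹ i j *
      α (e.symm y) (coordVec e j y)) * α (e.symm y) (coordVec e i y)) ?_ fun y hy => ?_)
    · exact continuousOn_finsetSum _ fun i _ => (continuousOn_finsetSum _ fun j _ =>
        (contDiffOn_gram_inv σ he i j).continuousOn.mul
          (continuousOn_oneForm_coordVec hα he j)).mul (continuousOn_oneForm_coordVec hα he i)
    · have h := congrArg (α (e.symm y)) (eq_sum_gram_inv σ he hy (hX (e.symm y)))
      refine h.trans ?_
      rw [map_sum]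
      exact Finset.sum_congr rfl fun i _ => by rw [map_smul, smul_eq_mul]
  obtain ⟨B, hB⟩ := isCompact_univ.bddAbove_image hc.continuousOn
  refine ⟨√B, Real.sqrt_nonneg _, fun f x => ?_⟩
  rw [← hX x]
  refine (abs_inner_grad_le σ f (X x)).trans
    (mul_le_mul_of_nonneg_right (Real.sqrt_le_sqrt ?_) (gradNorm_nonneg σ f x))
  rw [hX x]
  exact hB (mem_image_of_mem _ (mem_univ x))

end OneForm

/-! ### The `cosh` inequality and the Hamiltonian after integration by parts. -/

section Hamiltonian

open Set Topology

/-- The tangent line inequality for `cosh`. -/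
theorem cosh_add_sinh_mul_sub_le (s t : ℝ) :
    Real.cosh t + Real.sinh t * (s - t) ≤ Real.cosh s := by
  have h1 : Real.exp t * (s - t + 1) ≤ Real.exp s := by
    calc _ ≤ Real.exp t * Real.exp (s - t) := by gcongr; exact Real.add_one_le_exp _
      _ = Real.exp s := by rw [← Real.exp_add]; congr 1; ring
  have h2 : Real.exp (-t) * (t - s + 1) ≤ Real.exp (-s) := by
    calc _ ≤ Real.exp (-t) * Real.exp (t - s) := by gcongr; exact Real.add_one_le_exp _
      _ = Real.exp (-s) := by rw [← Real.exp_add]; congr 1; ring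
  rw [Real.cosh_eq, Real.sinh_eq, Real.cosh_eq]
  linarith

/-- The tangent line to `cosh` at `t` is evaluated at `K` or `-K`, according to the sign of `sinh
t`. With `t = θ`, the term in `K` becomes a multiple of `|Δτ|`, which pays for the gradient. -/
theorem cosh_sub_mul_sinh_add_le (K t : ℝ) :
    Real.cosh t - t * Real.sinh t + K * |Real.sinh t| ≤ Real.cosh K := by
  rcases abs_cases (Real.sinh t) with ⟨h, -⟩ | ⟨h, -⟩
  · rw [h]
    linarith [cosh_add_sinh_mul_sub_le K t]
  · have := cosh_add_sinh_mul_sub_le (-K) t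
    rw [Real.cosh_neg] at this
    rw [h]
    linarith

variable {M : Type*} [TopologicalSpace M] [ChartedSpace Plane M] [IsManifold (𝓡 2) ∞ M]

theorem gradFactor_pos (σ : Metric M) (f : M → ℝ) (x : M) : 0 < gradFactor σ f x :=
  Real.sqrt_pos.2 (add_pos_of_pos_of_nonneg one_pos (inner_self_nonneg σ _))

theorem gradFactor_le (σ : Metric M) (f : M → ℝ) (x : M) :
    gradFactor σ f x ≤ 1 + gradNorm σ f x := by
  have h := gradNorm_nonneg σ f x
  refine Real.sqrt_le_iff.2 ⟨by positivity, ?_⟩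
  have := gradNorm_sq σ f x
  rw [gradInner] at this
  nlinarith

/-- The square root causes no loss of regularity because its argument stays positive. -/
theorem contMDiff_gradFactor (σ : Metric M) {f : M → ℝ} (hf : ContMDiff (𝓡 2) 𝓘(ℝ, ℝ) 3 f) :
    ContMDiff (𝓡 2) 𝓘(ℝ, ℝ) 1 (gradFactor σ f) := by
  have h := contMDiff_gradInner σ (m := 1) (n := 3) (by norm_num) hf hf
  intro x
  exact (Real.contDiffAt_sqrt (x := 1 + gradInner σ f f x)
    (add_pos_of_pos_of_nonneg one_pos (inner_self_nonneg σ _)).ne').contMDiffAt.comp x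
    (contMDiffAt_const.add (h x))

variable [T2Space M] [CompactSpace M] [MeasurableSpace M] [BorelSpace M]

theorem contMDiff_angle (σ : Metric M) {h f : M → ℝ} (hh : ContMDiff (𝓡 2) 𝓘(ℝ, ℝ) 1 h)
    (hpos : ∀ x, 0 < h x) (hf : ContMDiff (𝓡 2) 𝓘(ℝ, ℝ) 3 f) :
    ContMDiff (𝓡 2) 𝓘(ℝ, ℝ) 1 (angle σ h f) := by
  have hd := hh.mul (contMDiff_gradFactor σ hf)
  have hq : ContMDiff (𝓡 2) 𝓘(ℝ, ℝ) 1 fun x => -laplacian σ f x / (h x * gradFactor σ f x) :=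
    (contMDiff_laplacian σ hf).neg.div₀ hd fun x => (mul_pos (hpos x) (gradFactor_pos σ f x)).ne'
  exact Real.contDiff_arsinh.contMDiff.comp hq

theorem laplacian_eq_mul_sinh_angle (σ : Metric M) {h : M → ℝ} (hpos : ∀ x, 0 < h x) (f : M → ℝ)
    (x : M) : laplacian σ f x = -(gradFactor σ f x * h x * Real.sinh (angle σ h f x)) := by
  have h1 := (hpos x).ne'
  have h2 := (gradFactor_pos σ f x).ne'
  rw [angle, Real.sinh_arsinh]
  field_simp

/-- The physical Hamiltonian after integration by parts. -/
theorem physicalHamiltonian_eq (σ : Metric M) {α : (x : M) → TangentSpace (𝓡 2) x →L[ℝ] ℝ}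
    (hα : IsC1OneForm α) {h τ : M → ℝ} (hh : ContMDiff (𝓡 2) 𝓘(ℝ, ℝ) 1 h)
    (hpos : ∀ x, 0 < h x) (hτ : ContMDiff (𝓡 2) 𝓘(ℝ, ℝ) 3 τ) :
    physicalHamiltonian σ h α τ =
      ∫ x, (gradFactor σ τ x * h x * (Real.cosh (angle σ h τ x) -
        angle σ h τ x * Real.sinh (angle σ h τ x)) - α x (grad σ τ x)) ∂(area σ) := by
  have hτ1 : ContMDiff (𝓡 2) 𝓘(ℝ, ℝ) 1 τ := hτ.of_le (by norm_num)
  have hθ := contMDiff_angle σ hh hpos hτ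
  have hw := (contMDiff_gradFactor σ hτ).continuous
  have hg := continuous_gradInner σ hθ hτ1
  have hΔ := (contMDiff_laplacian σ hτ).continuous
  have i1 : Integrable (fun x => gradFactor σ τ x * Real.cosh (angle σ h τ x) * h x) (area σ) :=
    integrable_area_of_continuous σ
      ((hw.mul (Real.continuous_cosh.comp hθ.continuous)).mul hh.continuous)
  have i2 := integrable_area_of_continuous σ hg
  have i3 := integrable_area_of_continuous σ (continuous_oneForm_grad σ hα hτ1)
  have i4 : Integrable (fun x => angle σ h τ x * laplacian σ τ x) (area σ) :=
    integrable_area_of_continuous σ (hθ.continuous.mul hΔ)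
  have i5 : Integrable (fun x => gradFactor σ τ x * Real.cosh (angle σ h τ x) * h x -
    gradInner σ (angle σ h τ) τ x) (area σ) := i1.sub i2
  have i6 : Integrable (fun x => gradFactor σ τ x * Real.cosh (angle σ h τ x) * h x +
    angle σ h τ x * laplacian σ τ x) (area σ) := i1.add i4
  calc physicalHamiltonian σ h α τ
      = ∫ x, (gradFactor σ τ x * Real.cosh (angle σ h τ x) * h x
          - gradInner σ (angle σ h τ) τ x - α x (grad σ τ x)) ∂(area σ) := by
        simp only [gradInner_comm σ (angle σ h τ) τ]
        rfl
    _ = ∫ x, (gradFactor σ τ x * Real.cosh (angle σ h τ x) * h x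
          + angle σ h τ x * laplacian σ τ x - α x (grad σ τ x)) ∂(area σ) := by
        rw [integral_sub i5 i3, integral_sub i1 i2, integral_gradInner_eq σ hθ hτ,
          integral_sub i6 i3, integral_add i1 i4, sub_neg_eq_add]
    _ = _ := by
        refine integral_congr_ae (Filter.Eventually.of_forall fun x => ?_)
        dsimp only
        rw [laplacian_eq_mul_sinh_angle σ hpos]
        ring

end Hamiltonian

end QuasiLocal

/-! ### The upper bound for the Hamiltonian. -/

open QuasiLocal in
theorem mainTheorem8 {M : Type*} [TopologicalSpace M] [T2Space M] [CompactSpace M]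
    [ConnectedSpace M] [ChartedSpace QuasiLocal.Plane M] [IsManifold (𝓡 2) ∞ M]
    [MeasurableSpace M] [BorelSpace M]
    (σ : QuasiLocal.Metric M) (α : (x : M) → TangentSpace (𝓡 2) x →L[ℝ] ℝ)
    (hα : QuasiLocal.IsC1OneForm α) :
    ∃ ε > 0, ∃ b > 0, ∀ h : M → ℝ, ContMDiff (𝓡 2) 𝓘(ℝ, ℝ) 1 h →
      (∀ x, 0 < h x) → (∀ x, h x < ε) →
      ∀ τ : M → ℝ, ContMDiff (𝓡 2) 𝓘(ℝ, ℝ) 3 τ →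
        QuasiLocal.physicalHamiltonian σ h α τ
          < Real.cosh b * ∫ x, h x ∂(QuasiLocal.area σ) := by
  obtain ⟨C, hC, hgrad⟩ := exists_integral_gradNorm_le σ
  obtain ⟨a, ha, hαle⟩ := exists_abs_oneForm_grad_le σ hα
  -- With this choice `(a + 1) ‖∇τ‖₁ ≤ K ‖Δτ‖₁`.
  set K := C * (a + 1) with hK
  have hK0 : 0 ≤ K := by positivity
  have hcosh := Real.cosh_pos K
  -- The threshold `1 / cosh K` gives `h cosh K ≤ 1`. Taking `b = K + 1` rather than `K` makes `b`
  -- positive even if `K = 0` and makes the inequality strict.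
  refine ⟨1 / Real.cosh K, by positivity, K + 1, by positivity, fun h hh hpos hε τ hτ => ?_⟩
  have hτ1 : ContMDiff (𝓡 2) 𝓘(ℝ, ℝ) 1 τ := hτ.of_le (by norm_num)
  have hθ := (contMDiff_angle σ hh hpos hτ).continuous
  have hw := (contMDiff_gradFactor σ hτ).continuous
  have hn := continuous_gradNorm σ hτ1
  have hΔ := (contMDiff_laplacian σ hτ).continuous
  have iα := integrable_area_of_continuous σ (continuous_oneForm_grad σ hα hτ1)
  have iH := integrable_area_of_continuous σ ((hw.mul hh.continuous).mul
    ((Real.continuous_cosh.comp hθ).sub (hθ.mul (Real.continuous_sinh.comp hθ))))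
  have ih := (integrable_area_of_continuous σ hh.continuous).const_mul (Real.cosh K)
  have iΔ := (integrable_area_of_continuous σ hΔ.abs).const_mul K
  have iG := (integrable_area_of_continuous σ hn).const_mul (a + 1)
  have hpt : ∀ x, gradFactor σ τ x * h x * (Real.cosh (angle σ h τ x) -
      angle σ h τ x * Real.sinh (angle σ h τ x)) - α x (grad σ τ x) ≤
      Real.cosh K * h x - K * |laplacian σ τ x| + (a + 1) * gradNorm σ τ x := by
    intro x
    have hwh := mul_pos (gradFactor_pos σ τ x) (hpos x)
    have h1 := mul_le_mul_of_nonneg_left (cosh_sub_mul_sinh_add_le K (angle σ h τ x)) hwh.le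
    have h2 : |laplacian σ τ x| = gradFactor σ τ x * h x * |Real.sinh (angle σ h τ x)| := by
      rw [laplacian_eq_mul_sinh_angle σ hpos, abs_neg, abs_mul, abs_of_pos hwh]
    have h3 : Real.cosh K * h x ≤ 1 := by
      have := (hε x).le
      rwa [le_div_iff₀' hcosh] at this
    have hg := gradNorm_nonneg σ τ x
    -- The excess of `w` over `1` is at most `|∇τ|`, and smallness of `h` keeps its coefficient at
    -- most `1`; this is the `1` in `a + 1`.
    have h4 : gradFactor σ τ x * h x * Real.cosh K ≤ Real.cosh K * h x + gradNorm σ τ x := by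
      calc _ ≤ (1 + gradNorm σ τ x) * h x * Real.cosh K := by
            have := gradFactor_le σ τ x
            have := (hpos x).le
            gcongr
        _ = Real.cosh K * h x + Real.cosh K * h x * gradNorm σ τ x := by ring
        _ ≤ Real.cosh K * h x + 1 * gradNorm σ τ x := by gcongr
        _ = _ := by rw [one_mul]
    have h5 := (neg_le_abs _).trans (hαle τ x)
    rw [h2]
    linarith
  have hint : 0 < ∫ x, h x ∂(area σ) :=
    hh.continuous.integral_pos_of_hasCompactSupport_nonneg_nonzero
      (HasCompactSupport.of_compactSpace h) (fun x => (hpos x).le)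
      (x := Classical.arbitrary M) (hpos _).ne'
  calc physicalHamiltonian σ h α τ
      ≤ ∫ x, (Real.cosh K * h x - K * |laplacian σ τ x| + (a + 1) * gradNorm σ τ x) ∂(area σ) := by
        rw [physicalHamiltonian_eq σ hα hh hpos hτ]
        exact MeasureTheory.integral_mono (iH.sub iα) ((ih.sub iΔ).add iG) hpt
    _ = Real.cosh K * ∫ x, h x ∂(area σ) - K * ∫ x, |laplacian σ τ x| ∂(area σ)
          + (a + 1) * ∫ x, gradNorm σ τ x ∂(area σ) := by
        have i1 : MeasureTheory.Integrable (fun x => Real.cosh K * h x -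
            K * |laplacian σ τ x|) (area σ) := ih.sub iΔ
        rw [MeasureTheory.integral_add i1 iG, MeasureTheory.integral_sub ih iΔ]
        simp only [MeasureTheory.integral_const_mul]
    _ ≤ Real.cosh K * ∫ x, h x ∂(area σ) := by
        have := mul_le_mul_of_nonneg_left (hgrad τ hτ) (by positivity : 0 ≤ a + 1)
        rw [hK]
        linarith
    _ < Real.cosh (K + 1) * ∫ x, h x ∂(area σ) := by
        refine mul_lt_mul_of_pos_right ?_ hint
        rw [Real.cosh_lt_cosh, abs_of_nonneg hK0, abs_of_nonneg (by positivity)]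
        exact lt_add_one K
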